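/- **Setting.** Let $M$ be a two-sorted first-order structure with sorts $M_t$ (points) and $M_b$ (parameters), and let $\phi(x,y_1,\dots,y_k)$ be a formula, $x$ of sort $M_t$ and the $y_i$ of sort $M_b$, such that the *basis sets* $\phi(M_t,\bar b)$, $\bar b\in M_b^k$, form a basis of a Hausdorff topology on $M_t$. "Definable" means definable in $M$ with parameters. For definable $X\subseteq M_t$ let $d(X)\in\mathbb N\cup\{\infty\}$ be the supremum of all $d$ such that $X$ is a disjoint union of $d$ nonempty definable sets, each clopen in $X$; $X$ is *definably connected* if $d(X)=1$. For closed definable $X\subseteq M_t$ and an ordinal $\alpha$, the relation $D(X)\ge\alpha$ is defined by: $D(X)\ge 0$ if $X\ne\emptyset$; $D(X)\ge\delta$ for a limit ordinal $\delta$ if $D(X)\ge\alpha$ for all $\alpha<\delta$; $D(X)\ge\alpha+1$ if some closed definable $Y\subseteq X$ without interior in $X$ has $D(Y)\ge\alpha$. $M$ is *topologically totally transcendental (t.t.t.)* if every definable $X\subseteq M_t$ is a Boolean combination of definable open sets and has $d(X)<\infty$, and for every closed definable $X\subseteq M_t$ there is an ordinal $\alpha$ with $D(X)\not\ge\alpha$.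 It is *1-dimensional* if $D(M_t)\ge1$ and $D(M_t)\not\ge2$, and *$\omega$-saturated* if every type in finitely many variables over a finite parameter set (from both sorts) that is finitely satisfiable in $M$ is realized in $M$. A set $U\subseteq M_t$ is *o-minimal* if there is a definable dense linear order on $U$ whose order topology is the subspace topology of $U$ and for which every definable subset of $U$ is a finite union of points and open intervals with endpoints in $U\cup\{\pm\infty\}$. **Theorem.** Let $M$ be a 1-dimensional $\omega$-saturated t.t.t. structure such that one of the following holds: 1. there are a definable continuous function $F:M_t^2\to M_t$ and a point $a\in M_t$ such that for each $x\in M_t$, $F(x,x)=a$ and $F(x,\cdot)$ is injective; 2. every nonempty basis set $U$ has exactly two boundary points. Then for all but finitely many points $x\in M_t$: - $x$ has a definable open neighbourhood $D$ that is o-minimal, and every definably connected basis set $U\subseteq D$ is o-minimal too (so if $x$ has arbitrarily small definably connected basis neighbourhoods, then $x$ lies in an o-minimal basis set); - if (2) holds, then $x$ lies in a basis set that is o-minimal. -/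

import Mathlib

open FirstOrder Set

universe u v w w'

namespace TTT

/-! ### Two-sorted structures

A structure with sorts `Mt` (the points) and `Mb` (the parameters of the basis sets) is a
first-order structure on the disjoint union `Mt ⊕ Mb` in which the sort `Mt` is definable
without parameters. -/

/-- The two sorts are part of the structure. -/
def IsTwoSorted (L : FirstOrder.Language.{u, v}) (Mt : Type w) (Mb : Type w')
    [L.Structure (Mt ⊕ Mb)] : Prop :=
  (∅ : Set (Mt ⊕ Mb)).Definable₁ L (range (Sum.inl : Mt → Mt ⊕ Mb))

/-- A set of tuples of points is definable, with arbitrary parameters from both sorts. -/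
def DefinableRel (L : FirstOrder.Language.{u, v}) {Mt : Type w} (Mb : Type w') [L.Structure (Mt ⊕ Mb)]
    {n : ℕ} (R : Set (Fin n → Mt)) : Prop :=
  (univ : Set (Mt ⊕ Mb)).Definable L ((fun (x : Fin n → Mt) i => (Sum.inl (x i) : Mt ⊕ Mb)) '' R)

/-- A set of points is definable, with arbitrary parameters from both sorts. -/
def DefinableSet (L : FirstOrder.Language.{u, v}) {Mt : Type w} (Mb : Type w') [L.Structure (Mt ⊕ Mb)]
    (X : Set Mt) : Prop :=
  (univ : Set (Mt ⊕ Mb)).Definable₁ L ((Sum.inl : Mt → Mt ⊕ Mb) '' X)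

/-- A binary function on points is definable if its graph is. -/
def DefinableFun₂ (L : FirstOrder.Language.{u, v}) {Mt : Type w} (Mb : Type w') [L.Structure (Mt ⊕ Mb)]
    (F : Mt → Mt → Mt) : Prop :=
  DefinableRel L Mb {x : Fin 3 → Mt | F (x 0) (x 1) = x 2}

/-- Every type in finitely many variables over finitely many parameters that is finitely
satisfiable in `M` is realized in `M`. -/
def OmegaSaturated (L : FirstOrder.Language.{u, v}) (M : Type w) [L.Structure M] : Prop :=
  ∀ A : Set M, A.Finite → ∀ (n : ℕ) (p : Set (L[[A]].Formula (Fin n))),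
    (∀ q : Finset (L[[A]].Formula (Fin n)), (q : Set (L[[A]].Formula (Fin n))) ⊆ p →
      ∃ x : Fin n → M, ∀ θ ∈ q, θ.Realize x) →
    ∃ x : Fin n → M, ∀ θ ∈ p, θ.Realize x

/-! ### First order topological structures -/

/-- The set of points defined by `φ(x, b₁, …, bₖ)`, for `b₁, …, bₖ` in the sort `Mb`. -/
def basisSet {L : FirstOrder.Language.{u, v}} {Mt : Type w} {Mb : Type w'} [L.Structure (Mt ⊕ Mb)] {k : ℕ}
    (φ : L.Formula (Fin 1 ⊕ Fin k)) (b : Fin k → Mb) : Set Mt :=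
  {x | φ.Realize (Sum.elim (fun _ => Sum.inl x) (fun i => Sum.inr (b i)))}

/-- `U` is one of the basis sets given by `φ`. -/
def IsBasisSet {L : FirstOrder.Language.{u, v}} {Mt : Type w} {Mb : Type w'} [L.Structure (Mt ⊕ Mb)] {k : ℕ}
    (φ : L.Formula (Fin 1 ⊕ Fin k)) (U : Set Mt) : Prop :=
  ∃ b : Fin k → Mb, U = basisSet φ b

/-- `DimGE L Mb X α` says that `D(X) ≥ α`, for a closed definable set `X` of points. -/
inductive DimGE (L : FirstOrder.Language.{u, v}) {Mt : Type w} (Mb : Type w') [L.Structure (Mt ⊕ Mb)]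
    [TopologicalSpace Mt] : Set Mt → Ordinal.{w} → Prop
  | zero {X : Set Mt} : X.Nonempty → DimGE L Mb X 0
  | limit {X : Set Mt} {δ : Ordinal.{w}} : Order.IsSuccLimit δ →
      (∀ α, α < δ → DimGE L Mb X α) → DimGE L Mb X δ
  | succ {X Y : Set Mt} {α : Ordinal.{w}} : IsClosed Y → DefinableSet L Mb Y → Y ⊆ X →
      interior ((↑) ⁻¹' Y : Set X) = ∅ → DimGE L Mb Y α → DimGE L Mb X (α + 1)

/-- `Y` is a partition of `X` into `d` nonempty definable sets that are clopen in `X`. -/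
structure IsClopenPartition (L : FirstOrder.Language.{u, v}) {Mt : Type w} (Mb : Type w')
    [L.Structure (Mt ⊕ Mb)] [TopologicalSpace Mt] (X : Set Mt) {d : ℕ}
    (Y : Fin d → Set Mt) : Prop where
  nonempty : ∀ i, (Y i).Nonempty
  definable : ∀ i, DefinableSet L Mb (Y i)
  clopen : ∀ i, IsClopen ((↑) ⁻¹' (Y i) : Set X)
  disjoint : Pairwise fun i j => Disjoint (Y i) (Y j)
  union : ⋃ i, Y i = X

/-- The number `d(X)` of definably connected components of `X`; it is `⊤` if `X` has partitions
into arbitrarily many nonempty definable clopen pieces. -/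
noncomputable def compNum (L : FirstOrder.Language.{u, v}) {Mt : Type w} (Mb : Type w')
    [L.Structure (Mt ⊕ Mb)] [TopologicalSpace Mt] (X : Set Mt) : ℕ∞ :=
  ⨆ (d : ℕ) (_ : ∃ Y : Fin d → Set Mt, IsClopenPartition L Mb X Y), (d : ℕ∞)

/-- The two-sorted structure on `Mt`, `Mb`, with the topology on `Mt` whose basis is given by the
formula `φ`, is a (Hausdorff) topologically totally transcendental structure. -/
structure IsTTT {L : FirstOrder.Language.{u, v}} {Mt : Type w} {Mb : Type w'} [L.Structure (Mt ⊕ Mb)]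
    [TopologicalSpace Mt] {k : ℕ} (φ : L.Formula (Fin 1 ⊕ Fin k)) : Prop where
  twoSorted : IsTwoSorted L Mt Mb
  isBasis : TopologicalSpace.IsTopologicalBasis {U : Set Mt | IsBasisSet (Mb := Mb) φ U}
  hausdorff : T2Space Mt
  booleanCombination : ∀ X : Set Mt, DefinableSet L Mb X →
    X ∈ BooleanSubalgebra.closure {O : Set Mt | IsOpen O ∧ DefinableSet L Mb O}
  hasDimension : ∀ X : Set Mt, IsClosed X → DefinableSet L Mb X →
    ∃ α : Ordinal.{w}, ¬ DimGE L Mb X α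
  finite_compNum : ∀ X : Set Mt, DefinableSet L Mb X → compNum L Mb X < ⊤

/-- `D(Mt) = 1`. -/
def IsOneDimensional (L : FirstOrder.Language.{u, v}) (Mt : Type w) (Mb : Type w') [L.Structure (Mt ⊕ Mb)]
    [TopologicalSpace Mt] : Prop :=
  DimGE L Mb (univ : Set Mt) 1 ∧ ¬ DimGE L Mb (univ : Set Mt) (1 + 1)

/-! ### o-minimal sets -/

/-- A point, or an open interval with endpoints in `α ∪ {-∞, ∞}`. -/
def IsPointOrInterval {α : Type w} [LinearOrder α] (I : Set α) : Prop :=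
  (∃ a, I = {a}) ∨ (∃ a b, I = Ioo a b) ∨ (∃ a, I = Iio a) ∨ (∃ a, I = Ioi a) ∨ I = univ

/-- The set `U` of points, with the structure induced on it, is o-minimal: there is a definable
dense linear order on `U` inducing the topology of `U`, such that every definable subset of `U`
is a finite union of points and intervals. -/
def IsOMinimal (L : FirstOrder.Language.{u, v}) {Mt : Type w} (Mb : Type w') [L.Structure (Mt ⊕ Mb)]
    [TopologicalSpace Mt] (U : Set Mt) : Prop :=
  ∃ _ : LinearOrder U,
    DefinableRel L Mb {x : Fin 2 → Mt | ∃ (h₀ : x 0 ∈ U) (h₁ : x 1 ∈ U),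
      (⟨x 0, h₀⟩ : U) < ⟨x 1, h₁⟩} ∧
    DenselyOrdered U ∧ OrderTopology U ∧
    ∀ X : Set Mt, X ⊆ U → DefinableSet L Mb X →
      ∃ S : Set (Set U), S.Finite ∧ (∀ I ∈ S, IsPointOrInterval I) ∧
        ((↑) ⁻¹' X : Set U) = ⋃₀ S

/-! ### The two conditions -/

/-- There are a definable continuous `F : Mt² → Mt` and a point `a` such that, for every `x`,
`F(x, x) = a` and `F(x, ·)` is injective. -/
def HasDifferenceFun (L : FirstOrder.Language.{u, v}) (Mt : Type w) (Mb : Type w') [L.Structure (Mt ⊕ Mb)]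
    [TopologicalSpace Mt] : Prop :=
  ∃ (F : Mt → Mt → Mt) (a : Mt), DefinableFun₂ L Mb F ∧ Continuous (Function.uncurry F) ∧
    ∀ x, F x x = a ∧ Function.Injective (F x)

/-- Every (nonempty) basis set has exactly two boundary points. -/
def HasTwoPointBoundaries {L : FirstOrder.Language.{u, v}} {Mt : Type w} {Mb : Type w'}
    [L.Structure (Mt ⊕ Mb)] [TopologicalSpace Mt] {k : ℕ}
    (φ : L.Formula (Fin 1 ⊕ Fin k)) : Prop :=
  ∀ U : Set Mt, IsBasisSet (Mb := Mb) φ U → U.Nonempty → (frontier U).encard = 2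

end TTT

/-! Two finiteness facts drive everything. A closed definable set without interior is discrete
because the dimension is one, and a discrete definable set is finite because `d` is finite; hence
every definable set has finite boundary (`IsTTT.finite_frontier`). Finiteness of `d` for the
complement of a non-isolated point `z` also yields a rigidity principle
(`IsTTT.exists_nhds_frontier_subset`): near `z`, a definable open set with boundary inside `{z}` is
empty. Most order-theoretic facts below are proved by exhibiting an open set which this principle
forces to be empty.

All but finitely many points `x` are split by a basis set `C`, meaning that `C` and its complement
both accumulate at `x` (`IsTTT.finite_not_splits`). At such a point one constructs, on each of the
two sides, a definable family of open sets `A r` with boundary `{x, r}`, playing the role of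
intervals `(x, r)` (`IsHalfChart`). Under condition (1), `A r` is the region swept out when `F`
carries the boundary point `x` of `C` to `r` (`IsMovingFamily`). Under condition (2), `A r` is the
part on one side of a basis neighbourhood of `x` having `r` as a boundary point. It depends only on
`r`, because three disjoint definable open sets cannot accumulate at a common point
(`HasTwoPointBoundaries.not_three`).

Rigidity makes membership `r ∈ A t` a strict linear order on each side and gives an intermediate
value property. Gluing the two sides orders an open neighbourhood of `x`
(`IsHalfChart.isOrderChart`). Together with finiteness of boundaries, the intermediate value
property gives o-minimality (`IsOrderChart.isOMinimal`). Convex open definable subsets inherit the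
chart. This covers definably connected basis sets and, under (2), a small basis neighbourhood of
`x`, which is the interval between its two boundary points. -/

namespace TTT

/-! ### Definable predicates on sorts coded by tuples -/

/-- An injective coding of a type by finite tuples of elements of `M`, with definable range. -/
class DefCoding (L : FirstOrder.Language.{u, v}) (M : Type*) [L.Structure M] (X : Type*) where
  ι : Type
  fin : Finite ι
  code : X → ι → M
  inj : Function.Injective code
  definable_range : (univ : Set M).Definable L (range code)

section Coding

variable (L : FirstOrder.Language.{u, v}) (M : Type*) [L.Structure M]
variable {X Y Z : Type*} [DefCoding L M X] [DefCoding L M Y] [DefCoding L M Z]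

open DefCoding

/-- The coding as a function with explicit language and structure. -/
def enc (x : X) : ι L M X → M := code x

theorem enc_injective : Function.Injective (enc L M (X := X)) := inj

theorem sumElim_inj {α β γ : Type*} {a a' : α → γ} {b b' : β → γ}
    (h : Sum.elim a b = Sum.elim a' b') : a = a' ∧ b = b' :=
  ⟨funext fun i => congrFun h (.inl i), funext fun i => congrFun h (.inr i)⟩

theorem definable_range_enc : (univ : Set M).Definable L (range (enc L M (X := X))) :=
  definable_range

instance : Finite (ι L M X) := fin

/-- A predicate on a coded type is definable with parameters. -/
def DefPred (P : X → Prop) : Prop :=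
  (univ : Set M).Definable L (enc L M '' {x | P x})

/-- A function between coded types is definable with parameters. -/
@[fun_prop]
def DefMap (f : X → Y) : Prop :=
  (univ : Set M).Definable L {v : ι L M X ⊕ ι L M Y → M |
    ∃ x, enc L M x = v ∘ Sum.inl ∧ enc L M (f x) = v ∘ Sum.inr}

variable {L M}

theorem DefPred.of_preimage {P : X → Prop} {S : Set (ι L M X → M)}
    (hS : (univ : Set M).Definable L S) (h : ∀ x, P x ↔ enc L M x ∈ S) : DefPred L M P := by
  have : enc L M '' {x | P x} = range (enc L M) ∩ S := by
    ext v
    constructor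
    · rintro ⟨x, hx, rfl⟩
      exact ⟨mem_range_self x, (h x).1 hx⟩
    · rintro ⟨⟨x, rfl⟩, hx⟩
      exact ⟨x, (h x).2 hx, rfl⟩
  unfold DefPred
  rw [this]
  exact (definable_range_enc L M).inter hS

theorem enc_mem_image {P : X → Prop} (x : X) : enc L M x ∈ enc L M '' {x | P x} ↔ P x :=
  (enc_injective L M).mem_set_image

theorem DefPred.and {P Q : X → Prop} (hP : DefPred L M P) (hQ : DefPred L M Q) :
    DefPred L M fun x => P x ∧ Q x :=
  .of_preimage (hP.inter hQ) fun x => by simp only [mem_inter_iff, enc_mem_image]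

theorem DefPred.or {P Q : X → Prop} (hP : DefPred L M P) (hQ : DefPred L M Q) :
    DefPred L M fun x => P x ∨ Q x :=
  .of_preimage (hP.union hQ) fun x => by simp only [mem_union, enc_mem_image]

theorem DefPred.not {P : X → Prop} (hP : DefPred L M P) : DefPred L M fun x => ¬ P x :=
  .of_preimage hP.compl fun x => by rw [mem_compl_iff, enc_mem_image]

theorem DefPred.imp {P Q : X → Prop} (hP : DefPred L M P) (hQ : DefPred L M Q) :
    DefPred L M fun x => P x → Q x := by
  simpa only [imp_iff_not_or] using hP.not.or hQ

theorem DefPred.iff {P Q : X → Prop} (hP : DefPred L M P) (hQ : DefPred L M Q) :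
    DefPred L M fun x => P x ↔ Q x := by
  simpa only [iff_iff_implies_and_implies] using (hP.imp hQ).and (hQ.imp hP)

theorem DefPred.const (p : Prop) : DefPred L M fun _ : X => p := by
  by_cases h : p
  · exact .of_preimage definable_univ fun x => by simp [h]
  · exact .of_preimage definable_empty fun x => by simp [h]

theorem DefPred.forall_finite {κ : Type*} [Finite κ] {P : κ → X → Prop}
    (hP : ∀ i, DefPred L M (P i)) : DefPred L M fun x => ∀ i, P i x :=
  .of_preimage (definable_iInter_of_finite hP) fun x => by
    simp only [mem_iInter, enc_mem_image]

instance : DefCoding L M (X × Y) where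
  ι := ι L M X ⊕ ι L M Y
  fin := inferInstance
  code p := Sum.elim (enc L M p.1) (enc L M p.2)
  inj p q h := by
    obtain ⟨h1, h2⟩ := sumElim_inj h
    exact Prod.ext (enc_injective L M h1) (enc_injective L M h2)
  definable_range := by
    convert! (Definable.preimage_comp (Sum.inl : ι L M X → ι L M X ⊕ ι L M Y)
      (definable_range_enc L M (X := X))).inter
      (Definable.preimage_comp (Sum.inr : ι L M Y → ι L M X ⊕ ι L M Y)
      (definable_range_enc L M (X := Y))) using 1
    ext v
    constructor
    · rintro ⟨p, rfl⟩
      exact ⟨⟨p.1, rfl⟩, ⟨p.2, rfl⟩⟩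
    · rintro ⟨⟨x, hx⟩, ⟨y, hy⟩⟩
      refine ⟨(x, y), ?_⟩
      simp only [hx, hy]
      exact Sum.elim_comp_inl_inr v

theorem enc_prod (p : X × Y) : enc L M p = Sum.elim (enc L M p.1) (enc L M p.2) := rfl

theorem DefPred.fst {P : X → Prop} (hP : DefPred L M P) : DefPred L M fun p : X × Y => P p.1 :=
  .of_preimage (Definable.preimage_comp (Sum.inl : ι L M X → ι L M X ⊕ ι L M Y) hP) fun p => by
    rw [enc_prod, mem_preimage, Sum.elim_comp_inl, enc_mem_image]

theorem DefPred.snd {P : Y → Prop} (hP : DefPred L M P) : DefPred L M fun p : X × Y => P p.2 :=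
  .of_preimage (Definable.preimage_comp (Sum.inr : ι L M Y → ι L M X ⊕ ι L M Y) hP) fun p => by
    rw [enc_prod, mem_preimage, Sum.elim_comp_inr, enc_mem_image]

theorem DefPred.exists {P : X → Y → Prop} (hP : DefPred L M fun p : X × Y => P p.1 p.2) :
    DefPred L M fun x => ∃ y, P x y := by
  refine .of_preimage (Definable.exists_of_finite hP) fun x => ?_
  constructor
  · rintro ⟨y, hy⟩
    exact ⟨enc L M y, (x, y), hy, rfl⟩
  · rintro ⟨u, ⟨x', y⟩, hy, h⟩
    obtain ⟨h1, h2⟩ := sumElim_inj h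
    obtain rfl := enc_injective L M h1
    exact ⟨y, hy⟩

theorem DefPred.forall {P : X → Y → Prop} (hP : DefPred L M fun p : X × Y => P p.1 p.2) :
    DefPred L M fun x => ∀ y, P x y := by
  have := (DefPred.exists (P := fun x y => ¬ P x y) hP.not).not
  simpa only [not_exists, not_not] using this

/-- Functions which only rearrange coordinates are definable. -/
theorem DefMap.of_coord {f : X → Y} (σ : ι L M Y → ι L M X)
    (h : ∀ x, enc L M (f x) = enc L M x ∘ σ) : DefMap L M f := by
  have h1 : (univ : Set M).Definable L {v : ι L M X ⊕ ι L M Y → M |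
      ∀ i, v (Sum.inr i) = v (Sum.inl (σ i))} := by
    rw [ofPred_forall]
    exact definable_iInter_of_finite fun i =>
      DefinableFun.ofPred_eq (by fun_prop) (by fun_prop)
  unfold DefMap
  convert! (Definable.preimage_comp (Sum.inl : ι L M X → ι L M X ⊕ ι L M Y)
      (definable_range_enc L M (X := X))).inter h1 using 1
  ext v
  constructor
  · rintro ⟨x, hx, hy⟩
    refine ⟨⟨x, hx⟩, fun i => ?_⟩
    have := congrFun hy i
    rw [h, hx] at this
    exact this.symm
  · rintro ⟨⟨x, hx⟩, hv⟩
    refine ⟨x, hx, ?_⟩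
    rw [h, hx]
    funext i
    exact (hv i).symm

theorem defMap_iff {f : X → Y} : DefMap L M f ↔ DefPred L M fun p : X × Y => f p.1 = p.2 := by
  unfold DefMap DefPred
  refine iff_of_eq (congrArg _ ?_)
  ext v
  constructor
  · rintro ⟨x, hx, hy⟩
    refine ⟨(x, f x), rfl, ?_⟩
    rw [enc_prod, hx, hy]
    exact Sum.elim_comp_inl_inr v
  · rintro ⟨⟨x, y⟩, hxy, rfl⟩
    obtain rfl : f x = y := hxy
    exact ⟨x, rfl, rfl⟩

theorem DefPred.comp {P : Y → Prop} {f : X → Y} (hP : DefPred L M P) (hf : DefMap L M f) :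
    DefPred L M fun x => P (f x) := by
  have := DefPred.exists (P := fun x y => f x = y ∧ P y) ((defMap_iff.1 hf).and hP.snd)
  simpa only [exists_eq_left'] using this

@[fun_prop]
theorem DefMap.id' : DefMap L M fun x : X => x := .of_coord id fun _ => rfl

@[fun_prop]
theorem DefMap.fst' : DefMap L M (Prod.fst : X × Y → X) := .of_coord Sum.inl fun _ => rfl

@[fun_prop]
theorem DefMap.snd' : DefMap L M (Prod.snd : X × Y → Y) := .of_coord Sum.inr fun _ => rfl

theorem DefPred.eq' : DefPred L M fun p : X × X => p.1 = p.2 := defMap_iff.1 .id'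

@[fun_prop]
theorem DefMap.comp' {g : Y → Z} {f : X → Y} (hg : DefMap L M g) (hf : DefMap L M f) :
    DefMap L M fun x => g (f x) := by
  -- These rearrangements are given by coordinates, since the composition rule itself rests on them.
  have h1 : DefMap L M fun q : (X × Z) × Y => (q.2, q.1.2) :=
    .of_coord (Sum.elim Sum.inr (Sum.inl ∘ Sum.inr)) fun q => by
      funext i; rcases i with i | i <;> rfl
  have h2 : DefMap L M fun q : (X × Z) × Y => (q.1.1, q.2) :=
    .of_coord (Sum.elim (Sum.inl ∘ Sum.inl) Sum.inr) fun q => by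
      funext i; rcases i with i | i <;> rfl
  rw [defMap_iff] at hf hg ⊢
  have := DefPred.exists (P := fun (p : X × Z) (y : Y) => f p.1 = y ∧ g y = p.2)
    ((hf.comp h2).and (hg.comp h1))
  simpa only [exists_eq_left'] using this

@[fun_prop]
theorem DefMap.prodMk {f : X → Y} {g : X → Z} (hf : DefMap L M f) (hg : DefMap L M g) :
    DefMap L M fun x => (f x, g x) := by
  have h1 : DefMap L M fun q : X × (Y × Z) => (q.1, q.2.1) :=
    .of_coord (Sum.elim Sum.inl (Sum.inr ∘ Sum.inl)) fun q => by
      funext i; rcases i with i | i <;> rfl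
  have h2 : DefMap L M fun q : X × (Y × Z) => (q.1, q.2.2) :=
    .of_coord (Sum.elim Sum.inl (Sum.inr ∘ Sum.inr)) fun q => by
      funext i; rcases i with i | i <;> rfl
  rw [defMap_iff] at hf hg ⊢
  simpa only [Prod.ext_iff] using (hf.comp h1).and (hg.comp h2)

theorem DefPred.eq {f g : X → Y} (hf : DefMap L M f) (hg : DefMap L M g) :
    DefPred L M fun x => f x = g x :=
  DefPred.eq'.comp (f := fun x => (f x, g x)) (by fun_prop)

@[fun_prop]
theorem DefMap.const' (c : Y) : DefMap L M fun _ : X => c := by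
  have h : DefPred L M fun y : Y => c = y := by
    have h1 : (univ : Set M).Definable L {v : ι L M Y → M | ∀ i, v i = enc L M c i} := by
      rw [ofPred_forall]
      exact definable_iInter_of_finite fun i =>
        DefinableFun.ofPred_eq_const (by fun_prop) (mem_univ _)
    refine .of_preimage h1 fun y => ?_
    rw [mem_ofPred_eq, ← funext_iff, (enc_injective L M).eq_iff, eq_comm]
  exact defMap_iff.2 h.snd

instance (κ : Type) [Finite κ] : DefCoding L M (κ → X) where
  ι := κ × ι L M X
  fin := inferInstance
  code x i := enc L M (x i.1) i.2
  inj x y h := funext fun i => enc_injective L M (funext fun j => congrFun h (i, j))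
  definable_range := by
    convert! definable_iInter_of_finite fun i : κ =>
      Definable.preimage_comp (fun j : ι L M X => (i, j)) (definable_range_enc L M (X := X)) using 1
    ext v
    simp only [mem_range, mem_iInter, mem_preimage]
    constructor
    · rintro ⟨x, rfl⟩ i
      exact ⟨x i, rfl⟩
    · intro h
      choose x hx using h
      exact ⟨x, funext fun ⟨i, j⟩ => congrFun (hx i) j⟩

@[fun_prop]
theorem DefMap.apply {κ : Type} [Finite κ] (i : κ) : DefMap L M fun x : κ → X => x i :=
  .of_coord (fun j => (i, j)) fun _ => rfl

@[fun_prop]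
theorem DefMap.pi {κ : Type} [Finite κ] {f : Y → κ → X} (hf : ∀ i, DefMap L M fun y => f y i) :
    DefMap L M f := by
  rw [defMap_iff]
  simp only [funext_iff]
  exact .forall_finite fun i => .eq (by have := hf i; fun_prop) (by fun_prop)

end Coding

/-! ### The two sorts as coded types, and definability of the basis family -/

section TwoSorted

variable {L : FirstOrder.Language.{u, v}} {Mt : Type w} {Mb : Type w'} [L.Structure (Mt ⊕ Mb)]
variable [hts : Fact (IsTwoSorted L Mt Mb)]

instance : DefCoding L (Mt ⊕ Mb) Mt where
  ι := Unit
  fin := inferInstance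
  code x _ := Sum.inl x
  inj x y h := Sum.inl_injective (congrFun h ())
  definable_range := by
    convert! (hts.out.mono (empty_subset univ)).preimage_comp (fun _ : Fin 1 => ()) using 1
    ext v
    constructor
    · rintro ⟨x, rfl⟩
      exact ⟨x, rfl⟩
    · rintro ⟨x, hx⟩
      exact ⟨x, funext fun _ => hx⟩

instance : DefCoding L (Mt ⊕ Mb) Mb where
  ι := Unit
  fin := inferInstance
  code x _ := Sum.inr x
  inj x y h := Sum.inr_injective (congrFun h ())
  definable_range := by
    convert! ((hts.out.mono (empty_subset univ)).preimage_comp (fun _ : Fin 1 => ())).compl using 1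
    ext v
    constructor
    · rintro ⟨x, rfl⟩ ⟨y, hy⟩
      exact Sum.inl_ne_inr hy
    · intro h
      rcases hv : v () with x | x
      · exact (h ⟨x, hv.symm⟩).elim
      · exact ⟨x, funext fun _ => hv.symm⟩

theorem definableSet_iff {X : Set Mt} :
    DefinableSet L Mb X ↔ DefPred L (Mt ⊕ Mb) fun x => x ∈ X := by
  constructor
  · intro h
    refine .of_preimage (h.preimage_comp (fun _ : Fin 1 => ())) fun x => ?_
    exact (Sum.inl_injective.mem_set_image).symm
  · intro h
    unfold DefinableSet Definable₁
    convert! h.preimage_comp (fun _ : Unit => (0 : Fin 1)) using 1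
    ext v
    constructor
    · rintro ⟨x, hx, h⟩
      exact ⟨x, hx, funext fun _ => h⟩
    · rintro ⟨x, hx, h⟩
      exact ⟨x, hx, congrFun h ()⟩

theorem definableRel_iff {n : ℕ} {R : Set (Fin n → Mt)} :
    DefinableRel L Mb R ↔ DefPred L (Mt ⊕ Mb) fun x => x ∈ R := by
  constructor
  · intro h
    refine .of_preimage (h.preimage_comp (fun i : Fin n => (i, ()))) fun x => ?_
    exact (Function.Injective.mem_set_image
      fun x y h => funext fun i => Sum.inl_injective (congrFun h i)).symm
  · intro h
    unfold DefinableRel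
    convert! h.preimage_comp (fun p : Fin n × Unit => p.1) using 1
    ext v
    constructor
    · rintro ⟨x, hx, rfl⟩
      exact ⟨x, hx, rfl⟩
    · rintro ⟨x, hx, h⟩
      exact ⟨x, hx, funext fun i => congrFun h (i, ())⟩

theorem defPred_basisSet {k : ℕ} (φ : L.Formula (Fin 1 ⊕ Fin k)) :
    DefPred L (Mt ⊕ Mb) fun p : (Fin k → Mb) × Mt => p.2 ∈ basisSet φ p.1 := by
  have h : (univ : Set (Mt ⊕ Mb)).Definable L {v : Fin 1 ⊕ Fin k → Mt ⊕ Mb | φ.Realize v} :=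
    Definable.mono (empty_definable_iff.2 ⟨φ, rfl⟩) (empty_subset _)
  refine .of_preimage (h.preimage_comp
    (Sum.elim (fun _ => .inr ()) fun i => .inl (i, ()))) fun p => ?_
  change φ.Realize _ ↔ φ.Realize _
  refine iff_of_eq (congrArg _ ?_)
  funext i
  rcases i with i | i <;> rfl

end TwoSorted
end TTT

namespace TTT

open Filter Topology

/-! ### Closure properties of definable sets of points -/

section Sets

variable {L : FirstOrder.Language.{u, v}} {Mt : Type w} {Mb : Type w'} [L.Structure (Mt ⊕ Mb)]
variable [Fact (IsTwoSorted L Mt Mb)] {X Y : Set Mt}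

theorem DefinableSet.inter (hX : DefinableSet L Mb X) (hY : DefinableSet L Mb Y) :
    DefinableSet L Mb (X ∩ Y) :=
  definableSet_iff.2 ((definableSet_iff.1 hX).and (definableSet_iff.1 hY))

theorem DefinableSet.union (hX : DefinableSet L Mb X) (hY : DefinableSet L Mb Y) :
    DefinableSet L Mb (X ∪ Y) :=
  definableSet_iff.2 ((definableSet_iff.1 hX).or (definableSet_iff.1 hY))

theorem DefinableSet.compl (hX : DefinableSet L Mb X) : DefinableSet L Mb Xᶜ :=
  definableSet_iff.2 (definableSet_iff.1 hX).not

theorem DefinableSet.diff (hX : DefinableSet L Mb X) (hY : DefinableSet L Mb Y) :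
    DefinableSet L Mb (X \ Y) :=
  hX.inter hY.compl

theorem DefinableSet.empty : DefinableSet L Mb (∅ : Set Mt) :=
  definableSet_iff.2 (DefPred.const False)

theorem DefinableSet.univ : DefinableSet L Mb (Set.univ : Set Mt) :=
  definableSet_iff.2 (DefPred.const True)

theorem DefinableSet.singleton (a : Mt) : DefinableSet L Mb ({a} : Set Mt) :=
  definableSet_iff.2 (DefPred.eq (f := fun x : Mt => x) (by fun_prop) (by fun_prop))

theorem DefinableSet.of_finite (hX : X.Finite) : DefinableSet L Mb X := by
  induction X, hX using Set.Finite.induction_on with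
  | empty => exact .empty
  | insert _ _ ih => exact (DefinableSet.singleton _).union ih

theorem DefinableSet.basisSet {k : ℕ} (φ : L.Formula (Fin 1 ⊕ Fin k)) (b : Fin k → Mb) :
    DefinableSet L Mb (basisSet (Mt := Mt) φ b) :=
  definableSet_iff.2 ((defPred_basisSet φ).comp (f := fun x : Mt => (b, x)) (by fun_prop))

theorem IsBasisSet.definableSet {k : ℕ} {φ : L.Formula (Fin 1 ⊕ Fin k)}
    (h : IsBasisSet (Mb := Mb) φ X) : DefinableSet L Mb X := by
  obtain ⟨b, rfl⟩ := h
  exact .basisSet φ b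

end Sets

/-! ### Definable topology and finiteness of boundaries -/

section Topology

variable {L : FirstOrder.Language.{u, v}} {Mt : Type w} {Mb : Type w'} [L.Structure (Mt ⊕ Mb)]
variable [Fact (IsTwoSorted L Mt Mb)] [TopologicalSpace Mt] {k : ℕ} {φ : L.Formula (Fin 1 ⊕ Fin k)}

/-- The basis is a single definable family, so closure is expressed by quantifying over its
parameters, uniformly in `z : Z`. -/
theorem IsTTT.defPred_closure (hM : IsTTT (Mt := Mt) (Mb := Mb) φ) {Z : Type*}
    [DefCoding L (Mt ⊕ Mb) Z] {A : Z → Set Mt}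
    (hA : DefPred L (Mt ⊕ Mb) fun p : Z × Mt => p.2 ∈ A p.1) :
    DefPred L (Mt ⊕ Mb) fun p : Z × Mt => p.2 ∈ closure (A p.1) := by
  have h : ∀ p : Z × Mt, p.2 ∈ closure (A p.1) ↔
      ∀ b : Fin k → Mb, p.2 ∈ TTT.basisSet φ b → ∃ y, y ∈ TTT.basisSet φ b ∧ y ∈ A p.1 := by
    intro p
    rw [hM.isBasis.mem_closure_iff]
    constructor
    · exact fun h b hb => h _ ⟨b, rfl⟩ hb
    · rintro h _ ⟨b, rfl⟩ hb
      exact h b hb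
  simp only [h]
  have hφ := defPred_basisSet (Mt := Mt) (Mb := Mb) φ
  refine DefPred.forall (DefPred.imp ?_ (DefPred.exists (DefPred.and ?_ ?_)))
  · exact hφ.comp (f := fun q : (Z × Mt) × (Fin k → Mb) => (q.2, q.1.2)) (by fun_prop)
  · exact hφ.comp (f := fun q : ((Z × Mt) × (Fin k → Mb)) × Mt => (q.1.2, q.2)) (by fun_prop)
  · exact hA.comp (f := fun q : ((Z × Mt) × (Fin k → Mb)) × Mt => (q.1.1.1, q.2)) (by fun_prop)

theorem IsTTT.defPred_frontier (hM : IsTTT (Mt := Mt) (Mb := Mb) φ) {Z : Type*}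
    [DefCoding L (Mt ⊕ Mb) Z] {A : Z → Set Mt}
    (hA : DefPred L (Mt ⊕ Mb) fun p : Z × Mt => p.2 ∈ A p.1) :
    DefPred L (Mt ⊕ Mb) fun p : Z × Mt => p.2 ∈ frontier (A p.1) := by
  simp only [frontier_eq_closure_inter_closure]
  exact (hM.defPred_closure hA).and (hM.defPred_closure (A := fun z => (A z)ᶜ) hA.not)

variable {X Y : Set Mt}

theorem IsTTT.definableSet_closure (hM : IsTTT (Mt := Mt) (Mb := Mb) φ)
    (hX : DefinableSet L Mb X) : DefinableSet L Mb (closure X) :=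
  definableSet_iff.2 <| (hM.defPred_closure (Z := Mt) (A := fun _ => X)
    (definableSet_iff.1 hX).snd).comp (f := fun x : Mt => (x, x)) (by fun_prop)

theorem IsTTT.definableSet_interior (hM : IsTTT (Mt := Mt) (Mb := Mb) φ)
    (hX : DefinableSet L Mb X) : DefinableSet L Mb (interior X) := by
  rw [interior_eq_compl_closure_compl]
  exact (hM.definableSet_closure hX.compl).compl

theorem IsTTT.definableSet_frontier (hM : IsTTT (Mt := Mt) (Mb := Mb) φ)
    (hX : DefinableSet L Mb X) : DefinableSet L Mb (frontier X) :=
  (hM.definableSet_closure hX).diff (hM.definableSet_interior hX)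

theorem IsTTT.isOpen_of_isBasisSet (hM : IsTTT (Mt := Mt) (Mb := Mb) φ)
    (h : IsBasisSet (Mb := Mb) φ X) : IsOpen X :=
  hM.isBasis.isOpen h

/-- A definable set has a finite subset which meets all its nonempty definable clopen subsets. -/
theorem IsTTT.exists_finite_transversal (hM : IsTTT (Mt := Mt) (Mb := Mb) φ)
    (hX : DefinableSet L Mb X) :
    ∃ P : Set Mt, P.Finite ∧ P ⊆ X ∧ ∀ Z ⊆ X, DefinableSet L Mb Z →
      IsClopen ((↑) ⁻¹' Z : Set X) → Z.Nonempty → (Z ∩ P).Nonempty := by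
  by_contra hcon
  have hne : X.Nonempty := by
    by_contra h
    refine hcon ⟨∅, finite_empty, empty_subset _, fun Z hZ _ _ hZn => ?_⟩
    exact (h (hZn.mono hZ)).elim
  -- Without a finite transversal, partitions can be refined forever: pick a point in each piece,
  -- take a clopen `Z` missing all of them, and replace the pieces `Y j` by `Z` and the still
  -- nonempty sets `Y j \ Z`.
  have key : ∀ d : ℕ, ∃ Y : Fin (d + 1) → Set Mt, IsClopenPartition L Mb X Y := by
    intro d
    induction d with
    | zero =>
      exact ⟨fun _ => X, fun _ => hne, fun _ => hX, fun _ => by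
        rw [Subtype.coe_preimage_self]; exact isClopen_univ,
        fun i j hij => (hij (Subsingleton.elim (α := Fin 1) _ _)).elim, iUnion_const X⟩
    | succ d ih =>
      obtain ⟨Y, hY⟩ := ih
      choose p hp using hY.nonempty
      have hsub : ∀ i, Y i ⊆ X := fun i => hY.union ▸ subset_iUnion Y i
      by_contra hno
      refine hcon ⟨range p, finite_range p, range_subset_iff.2 fun i => hsub i (hp i),
        fun Z hZ hZd hZc hZn => ?_⟩
      by_contra hZp
      refine hno ⟨Fin.cons Z fun j => Y j \ Z, ?_, ?_, ?_, ?_, ?_⟩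
      · refine Fin.cases hZn fun j => ?_
        exact ⟨p j, hp j, fun h => hZp ⟨p j, h, mem_range_self j⟩⟩
      · refine Fin.cases hZd fun j => (hY.definable j).diff hZd
      · refine Fin.cases hZc fun j => ?_
        exact (hY.clopen j).diff hZc
      · intro i j
        refine Fin.cases ?_ (fun i => ?_) i <;> refine Fin.cases ?_ (fun j => ?_) j
        · exact fun h => (h rfl).elim
        · exact fun _ => disjoint_sdiff_right
        · exact fun _ => disjoint_sdiff_left
        · intro h
          exact (hY.disjoint fun h' => h (congrArg _ h')).mono sdiff_subset sdiff_subset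
      · ext x
        rw [mem_iUnion, Fin.exists_fin_succ]
        simp only [Fin.cons_zero, Fin.cons_succ]
        have hx : x ∈ X ↔ ∃ i, x ∈ Y i := by rw [← hY.union, mem_iUnion]
        by_cases hxZ : x ∈ Z
        · simp [hxZ, hZ hxZ]
        · simp [hxZ, hx]
  refine (hM.finite_compNum X hX).ne (ENat.eq_top_iff_forall_ge.2 fun d => ?_)
  refine le_trans ?_ (le_iSup₂_of_le (d + 1) (key d) le_rfl)
  exact_mod_cast Nat.le_succ d

/-- Each singleton is clopen in `X`, so a finite transversal already contains all of `X`. -/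
theorem IsTTT.finite_of_discrete (hM : IsTTT (Mt := Mt) (Mb := Mb) φ)
    (hX : DefinableSet L Mb X) (hd : ∀ x ∈ X, ∃ U : Set Mt, IsOpen U ∧ U ∩ X = {x}) :
    X.Finite := by
  have := hM.hausdorff
  obtain ⟨P, hP, -, h⟩ := hM.exists_finite_transversal hX
  refine hP.subset fun x hx => ?_
  obtain ⟨U, hU, hUX⟩ := hd x hx
  have hop : IsOpen ((↑) ⁻¹' {x} : Set X) := by
    rw [← hUX, preimage_inter, Subtype.coe_preimage_self, inter_univ]
    exact hU.preimage continuous_subtype_val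
  obtain ⟨y, rfl, hy⟩ := h {x} (singleton_subset_iff.2 hx) (.singleton x)
    ⟨isClosed_singleton.preimage continuous_subtype_val, hop⟩ (singleton_nonempty x)
  exact hy

/-- If some `x` were not isolated in `X`, the chain `{x} ⊆ X ⊆ Mt` would show that the dimension is
at least two. So `X` is discrete. -/
theorem IsTTT.finite_of_isClosed_of_interior_eq_empty (hM : IsTTT (Mt := Mt) (Mb := Mb) φ)
    (hdim : IsOneDimensional L Mt Mb) (hX : DefinableSet L Mb X) (hc : IsClosed X)
    (hi : interior X = ∅) : X.Finite := by
  have := hM.hausdorff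
  refine hM.finite_of_discrete hX fun x hx => ?_
  by_contra hno
  refine hdim.2 (DimGE.succ (Y := X) hc hX (subset_univ _) ?_ ?_)
  · rw [← isOpen_univ.isOpenMap_subtype_val.preimage_interior_eq_interior_preimage
      continuous_subtype_val, hi, preimage_empty]
  · rw [← zero_add (1 : Ordinal)]
    refine DimGE.succ (Y := {x}) isClosed_singleton (.singleton x) (singleton_subset_iff.2 hx) ?_
      (.zero (singleton_nonempty x))
    by_contra hne
    obtain ⟨y, hy⟩ := nonempty_iff_ne_empty.2 hne
    obtain ⟨V, hV, hVo, hyV⟩ := mem_interior.1 hy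
    obtain ⟨U, hU, rfl⟩ := isOpen_induced_iff.1 hVo
    refine hno ⟨U, hU, Subset.antisymm (fun z hz => hV (show (⟨z, hz.2⟩ : X) ∈ _ from hz.1)) ?_⟩
    have : (y : Mt) = x := hV hyV
    rintro z rfl
    exact ⟨this ▸ hyV, hx⟩

/-- In a one dimensional structure, definable sets have finite frontier. -/
theorem IsTTT.finite_frontier (hM : IsTTT (Mt := Mt) (Mb := Mb) φ)
    (hdim : IsOneDimensional L Mt Mb) (hX : DefinableSet L Mb X) : (frontier X).Finite := by
  have h := hM.booleanCombination X hX
  clear hX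
  -- Sets with finite boundary form a Boolean algebra, so only open definable sets matter; the
  -- boundary of an open set is closed without interior.
  induction h using BooleanSubalgebra.closure_bot_sup_induction with
  | mem O hO =>
    refine hM.finite_of_isClosed_of_interior_eq_empty hdim (hM.definableSet_frontier hO.2)
      isClosed_frontier (by rw [← frontier_compl]; exact interior_frontier hO.1.isClosed_compl)
  | bot => exact frontier_empty (X := Mt) ▸ finite_empty
  | sup A _ B _ hA hB =>
    exact (hA.union hB).subset ((frontier_union_subset A B).trans
      (union_subset_union inter_subset_left inter_subset_right))
  | compl A _ hA => exact (frontier_compl A).symm ▸ hA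

/-- Regularity follows from the Hausdorff property because the boundary of a basis set is finite:
shrink `V` away from its own boundary. -/
theorem IsTTT.exists_isBasisSet_closure_subset (hM : IsTTT (Mt := Mt) (Mb := Mb) φ)
    (hdim : IsOneDimensional L Mt Mb) {z : Mt} {U : Set Mt} (hU : IsOpen U) (hz : z ∈ U) :
    ∃ V : Set Mt, IsBasisSet (Mb := Mb) φ V ∧ z ∈ V ∧ closure V ⊆ U := by
  have := hM.hausdorff
  obtain ⟨V, hV, hzV, hVU⟩ := hM.isBasis.exists_subset_of_mem_open hz hU
  have hVo := hM.isOpen_of_isBasisSet hV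
  have hfin := hM.finite_frontier hdim (IsBasisSet.definableSet hV)
  have hzf : z ∉ frontier V := fun h => h.2 (by rwa [hVo.interior_eq])
  obtain ⟨N, N', hN, hN', hzN, hfN, hdis⟩ :
      SeparatedNhds {z} (frontier V) :=
    SeparatedNhds.of_isCompact_isCompact isCompact_singleton hfin.isCompact (by simpa using hzf)
  obtain ⟨W, hW, hzW, hWV⟩ := hM.isBasis.exists_subset_of_mem_open
    (⟨hzV, hzN rfl⟩ : z ∈ V ∩ N) (hVo.inter hN)
  refine ⟨W, hW, hzW, fun y hy => hVU ?_⟩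
  by_contra hyV
  have h1 : y ∈ frontier V := ⟨closure_mono (hWV.trans inter_subset_left) hy, by
    rwa [hVo.interior_eq]⟩
  obtain ⟨t, ht, ht'⟩ := mem_closure_iff.1 hy N' hN' (hfN h1)
  exact disjoint_left.1 hdis (hWV ht').2 ht

theorem IsTTT.finite_isolated (hM : IsTTT (Mt := Mt) (Mb := Mb) φ) :
    {x : Mt | IsOpen ({x} : Set Mt)}.Finite := by
  refine hM.finite_of_discrete ?_ fun x hx => ⟨{x}, hx, ?_⟩
  · have h : ∀ x : Mt, IsOpen ({x} : Set Mt) ↔ ∃ b : Fin k → Mb, x ∈ TTT.basisSet φ b ∧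
        ∀ y, y ∈ TTT.basisSet φ b → y = x := by
      intro x
      constructor
      · intro hx
        obtain ⟨_, ⟨b, rfl⟩, hxb, hb⟩ := hM.isBasis.exists_subset_of_mem_open
          (mem_singleton x) hx
        exact ⟨b, hxb, fun y hy => hb hy⟩
      · rintro ⟨b, hxb, hb⟩
        rw [← (eq_singleton_iff_unique_mem.2 ⟨hxb, hb⟩ : TTT.basisSet φ b = {x})]
        exact hM.isOpen_of_isBasisSet ⟨b, rfl⟩
    rw [definableSet_iff]
    simp only [mem_ofPred_eq, h]
    have hφ := defPred_basisSet (Mt := Mt) (Mb := Mb) φ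
    refine DefPred.exists (DefPred.and ?_ (DefPred.forall (DefPred.imp ?_ ?_)))
    · exact hφ.comp (f := fun q : Mt × (Fin k → Mb) => (q.2, q.1)) (by fun_prop)
    · exact hφ.comp (f := fun q : (Mt × (Fin k → Mb)) × Mt => (q.1.2, q.2)) (by fun_prop)
    · exact DefPred.eq (f := fun q : (Mt × (Fin k → Mb)) × Mt => q.2) (by fun_prop) (by fun_prop)
  · exact inter_eq_left.2 (singleton_subset_iff.2 hx)

/-- Small neighbourhoods of a point that is not isolated contain no nonempty definable open sets
whose only possible boundary point is the given point. -/
theorem IsTTT.exists_nhds_frontier_subset (hM : IsTTT (Mt := Mt) (Mb := Mb) φ) {z : Mt}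
    (hz : ¬ IsOpen ({z} : Set Mt)) :
    ∃ U : Set Mt, IsOpen U ∧ z ∈ U ∧ ∀ Y ⊆ U, IsOpen Y → DefinableSet L Mb Y →
      frontier Y ⊆ {z} → Y = ∅ := by
  have := hM.hausdorff
  obtain ⟨P, hP, hPz, h⟩ := hM.exists_finite_transversal (DefinableSet.singleton z).compl
  -- `Y \ {z}` is clopen in the complement of `z` and misses the transversal `P`, so it is empty.
  -- The remaining case `Y = {z}` is excluded since `z` is not isolated.
  refine ⟨Pᶜ, hP.isClosed.isOpen_compl, fun h => hPz h rfl, fun Y hY hYo hYd hYf => ?_⟩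
  have h1 : Y \ {z} = ∅ := by
    by_contra hne
    have hcl : IsClosed ((↑) ⁻¹' (Y \ {z}) : Set ({z}ᶜ : Set Mt)) := by
      rw [isClosed_induced_iff]
      refine ⟨closure Y, isClosed_closure, ?_⟩
      ext ⟨y, hy⟩
      refine ⟨fun h => ⟨?_, hy⟩, fun h => subset_closure h.1⟩
      by_contra hyY
      exact hy (hYf ⟨h, by rwa [hYo.interior_eq]⟩)
    obtain ⟨y, hy, hyP⟩ := h (Y \ {z}) (fun y hy => hy.2) (hYd.diff (.singleton z))
      ⟨hcl, (hYo.sdiff isClosed_singleton).preimage continuous_subtype_val⟩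
      (nonempty_iff_ne_empty.2 hne)
    exact hY hy.1 hyP
  rcases subset_singleton_iff_eq.1 (sdiff_eq_empty.1 h1) with h | h
  · exact h
  · exact (hz (h ▸ hYo)).elim

end Topology

end TTT

namespace TTT

open Filter Topology

/-! ### Splitting points -/

/-- The set `Z` and its complement both accumulate at `x`. -/
def Splits {α : Type*} [TopologicalSpace α] (Z : Set α) (x : α) : Prop :=
  x ∈ closure (Z \ {x}) ∧ x ∈ closure (Zᶜ \ {x})

section Splitting

variable {L : FirstOrder.Language.{u, v}} {Mt : Type w} {Mb : Type w'} [L.Structure (Mt ⊕ Mb)]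
variable [Fact (IsTwoSorted L Mt Mb)] [TopologicalSpace Mt] {k : ℕ} {φ : L.Formula (Fin 1 ⊕ Fin k)}

theorem IsTTT.definableSet_splits (hM : IsTTT (Mt := Mt) (Mb := Mb) φ) :
    DefinableSet L Mb {x : Mt | ∃ b : Fin k → Mb, Splits (basisSet φ b) x} := by
  rw [definableSet_iff]
  have hφ : DefPred L (Mt ⊕ Mb) fun q : (Mt × (Fin k → Mb)) × Mt => q.2 ∈ basisSet φ q.1.2 :=
    (defPred_basisSet (Mt := Mt) (Mb := Mb) φ).comp
      (f := fun q : (Mt × (Fin k → Mb)) × Mt => (q.1.2, q.2)) (by fun_prop)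
  have hne : DefPred L (Mt ⊕ Mb) fun q : (Mt × (Fin k → Mb)) × Mt => ¬ q.2 = q.1.1 :=
    (DefPred.eq (by fun_prop) (by fun_prop)).not
  refine DefPred.exists (DefPred.and ?_ ?_)
  · exact (hM.defPred_closure (A := fun z : Mt × (Fin k → Mb) => basisSet φ z.2 \ {z.1})
      (hφ.and hne)).comp (f := fun z : Mt × (Fin k → Mb) => (z, z.1)) (by fun_prop)
  · exact (hM.defPred_closure (A := fun z : Mt × (Fin k → Mb) => (basisSet φ z.2)ᶜ \ {z.1})
      (hφ.not.and hne)).comp (f := fun z : Mt × (Fin k → Mb) => (z, z.1)) (by fun_prop)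

/-- All but finitely many points are split by a basis set. -/
theorem IsTTT.finite_not_splits (hM : IsTTT (Mt := Mt) (Mb := Mb) φ)
    (hdim : IsOneDimensional L Mt Mb) :
    {x : Mt | ∃ b : Fin k → Mb, Splits (basisSet φ b) x}ᶜ.Finite := by
  have := hM.hausdorff
  set S := {x : Mt | ∃ b : Fin k → Mb, Splits (basisSet φ b) x} with hS
  have hSd : DefinableSet L Mb S := hM.definableSet_splits
  refine ((hM.finite_frontier hdim hSd.compl).union hM.finite_isolated).subset fun x hx => ?_
  by_contra hcon
  obtain ⟨hxf, hxi⟩ := not_or.1 hcon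
  have hxint : x ∈ interior Sᶜ := by
    by_contra h
    exact hxf ⟨subset_closure hx, h⟩
  obtain ⟨P, hP, -, hPt⟩ := hM.exists_finite_transversal (DefinableSet.univ (L := L) (Mt := Mt))
  have hO : IsOpen (interior Sᶜ \ (P \ {x})) :=
    isOpen_interior.sdiff (hP.subset sdiff_subset).isClosed
  -- The point `x` itself may lie in `P`; as it is not isolated, a nearby point `y` outside `P` can
  -- replace it.
  obtain ⟨y, hyO, hyx⟩ : ∃ y ∈ interior Sᶜ \ (P \ {x}), y ≠ x := by
    by_contra h
    push Not at h
    refine hxi ?_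
    change IsOpen {x}
    rwa [← (eq_singleton_iff_unique_mem.2 ⟨⟨hxint, fun h => h.2 rfl⟩, h⟩ :
      interior Sᶜ \ (P \ {x}) = {x})]
  have hyP : y ∈ interior Sᶜ \ P := ⟨hyO.1, fun h => hyO.2 ⟨h, hyx⟩⟩
  obtain ⟨V, hV, hyV, hVO⟩ := hM.exists_isBasisSet_closure_subset hdim
    (isOpen_interior.sdiff hP.isClosed) hyP
  have hVo := hM.isOpen_of_isBasisSet hV
  -- A boundary point `p` of `V` is not split by `V`, so the complement of `V` does not accumulate
  -- at `p`, and `closure V` is a neighbourhood of `p`. Thus `closure V` is clopen, although it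
  -- misses the transversal `P`.
  have hop : IsOpen (closure V) := by
    rw [isOpen_iff_mem_nhds]
    intro p hp
    by_cases hpV : p ∈ V
    · exact mem_of_superset (hVo.mem_nhds hpV) subset_closure
    · have hpS : p ∉ S := interior_subset (hVO hp).1
      have h1 : p ∉ closure (Vᶜ \ {p}) := by
        intro h
        obtain ⟨b, rfl⟩ := hV
        exact hpS ⟨b, by rwa [sdiff_singleton_eq_self hpV], h⟩
      refine mem_of_superset (isClosed_closure.isOpen_compl.mem_nhds h1) fun q hq => ?_
      by_contra hqV
      have : q ∈ Vᶜ \ {p} := ⟨fun h => hqV (subset_closure h), fun h => hqV (h ▸ hp)⟩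
      exact hq (subset_closure this)
  obtain ⟨q, hq, hqP⟩ := hPt (closure V) (subset_univ _)
    (hM.definableSet_closure (IsBasisSet.definableSet hV))
    (IsClopen.preimage ⟨isClosed_closure, hop⟩ continuous_subtype_val) ⟨y, subset_closure hyV⟩
  exact (hVO hq).2 hqP

end Splitting

/-! ### Ordered charts -/

section Intervals

variable {α : Type*} [LinearOrder α]

/-- The open intervals with endpoints in `F` or infinite. -/
def intervals (F : Set α) : Set (Set α) :=
  image2 Ioo F F ∪ Iio '' F ∪ Ioi '' F ∪ {univ}

theorem finite_intervals {F : Set α} (hF : F.Finite) : (intervals F).Finite :=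
  (((hF.image2 _ hF).union (hF.image _)).union (hF.image _)).union (finite_singleton _)

theorem isPointOrInterval_of_mem_intervals {F : Set α} {I : Set α} (hI : I ∈ intervals F) :
    IsPointOrInterval I := by
  rcases hI with ((⟨a, -, b, -, rfl⟩ | ⟨b, -, rfl⟩) | ⟨a, -, rfl⟩) | rfl
  · exact .inr (.inl ⟨a, b, rfl⟩)
  · exact .inr (.inr (.inl ⟨b, rfl⟩))
  · exact .inr (.inr (.inr (.inl ⟨a, rfl⟩)))
  · exact .inr (.inr (.inr (.inr rfl)))

theorem ordConnected_of_mem_intervals {F : Set α} {I : Set α} (hI : I ∈ intervals F) :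
    I.OrdConnected := by
  rcases hI with ((⟨a, -, b, -, rfl⟩ | ⟨b, -, rfl⟩) | ⟨a, -, rfl⟩) | rfl
  · exact ordConnected_Ioo
  · exact ordConnected_Iio
  · exact ordConnected_Ioi
  · exact ordConnected_univ

theorem isOpen_of_mem_intervals [TopologicalSpace α] [OrderTopology α] {F : Set α} {I : Set α}
    (hI : I ∈ intervals F) : IsOpen I := by
  rcases hI with ((⟨a, -, b, -, rfl⟩ | ⟨b, -, rfl⟩) | ⟨a, -, rfl⟩) | rfl
  · exact isOpen_Ioo
  · exact isOpen_Iio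
  · exact isOpen_Ioi
  · exact isOpen_univ

theorem exists_mem_intervals {F : Set α} (hF : F.Finite) {y : α} (hy : y ∉ F) :
    ∃ I ∈ intervals F, y ∈ I ∧ Disjoint I F := by
  have hlt : ∀ {c}, c ∈ F → ¬ c < y → y < c := fun hc h =>
    lt_of_le_of_ne (not_lt.1 h) fun h' => hy (h' ▸ hc)
  by_cases ha : (F ∩ Iio y).Nonempty <;> by_cases hb : (F ∩ Ioi y).Nonempty
  · obtain ⟨a, haF, ha⟩ := exists_max_image _ id (hF.inter_of_left _) ha
    obtain ⟨b, hbF, hb⟩ := exists_min_image _ id (hF.inter_of_left _) hb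
    refine ⟨Ioo a b, .inl (.inl (.inl ⟨a, haF.1, b, hbF.1, rfl⟩)), ⟨haF.2, hbF.2⟩,
      disjoint_left.2 fun c hc hcF => ?_⟩
    by_cases h : c < y
    · exact (ha c ⟨hcF, h⟩).not_gt hc.1
    · exact (hb c ⟨hcF, hlt hcF h⟩).not_gt hc.2
  · obtain ⟨a, haF, ha⟩ := exists_max_image _ id (hF.inter_of_left _) ha
    refine ⟨Ioi a, .inl (.inr ⟨a, haF.1, rfl⟩), haF.2, disjoint_left.2 fun c hc hcF => ?_⟩
    by_cases h : c < y
    · exact (ha c ⟨hcF, h⟩).not_gt hc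
    · exact hb ⟨c, hcF, hlt hcF h⟩
  · obtain ⟨b, hbF, hb⟩ := exists_min_image _ id (hF.inter_of_left _) hb
    refine ⟨Iio b, .inl (.inl (.inr ⟨b, hbF.1, rfl⟩)), hbF.2, disjoint_left.2 fun c hc hcF => ?_⟩
    by_cases h : c < y
    · exact ha ⟨c, hcF, h⟩
    · exact (hb c ⟨hcF, hlt hcF h⟩).not_gt hc
  · refine ⟨univ, .inr rfl, mem_univ _, disjoint_left.2 fun c _ hcF => ?_⟩
    by_cases h : c < y
    · exact ha ⟨c, hcF, h⟩
    · exact hb ⟨c, hcF, hlt hcF h⟩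

end Intervals

/-- A definable linear order on the open set `D`, with open rays, for which definable sets satisfy
an intermediate value property. -/
structure IsOrderChart (L : FirstOrder.Language.{u, v}) {Mt : Type w} (Mb : Type w')
    [L.Structure (Mt ⊕ Mb)] [Fact (IsTwoSorted L Mt Mb)] [TopologicalSpace Mt] (D : Set Mt)
    (lt : Mt → Mt → Prop) : Prop where
  isOpen : IsOpen D
  definable : DefinableSet L Mb D
  definable_lt : DefPred L (Mt ⊕ Mb) fun p : Mt × Mt => lt p.1 p.2
  irrefl : ∀ r ∈ D, ¬ lt r r
  trans : ∀ r ∈ D, ∀ s ∈ D, ∀ t ∈ D, lt r s → lt s t → lt r t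
  total : ∀ r ∈ D, ∀ s ∈ D, r ≠ s → lt r s ∨ lt s r
  isOpen_lower : ∀ r ∈ D, IsOpen {s ∈ D | lt s r}
  isOpen_upper : ∀ r ∈ D, IsOpen {s ∈ D | lt r s}
  ivt : ∀ r ∈ D, ∀ s ∈ D, lt r s → ∀ P : Set Mt, DefinableSet L Mb P → r ∈ P → s ∉ P →
    ∃ z ∈ D, ¬ lt z r ∧ ¬ lt s z ∧ z ∈ frontier P

section Charts

variable {L : FirstOrder.Language.{u, v}} {Mt : Type w} {Mb : Type w'} [L.Structure (Mt ⊕ Mb)]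
variable [Fact (IsTwoSorted L Mt Mb)] [TopologicalSpace Mt] {k : ℕ} {φ : L.Formula (Fin 1 ⊕ Fin k)}
variable {D U : Set Mt} {lt : Mt → Mt → Prop}

namespace IsOrderChart

/-- The linear order given by an ordered chart. -/
noncomputable abbrev linearOrder (h : IsOrderChart L Mb D lt) : LinearOrder D :=
  letI : IsStrictTotalOrder D (fun r s : D => lt r s) :=
    { irrefl := fun r => h.irrefl r r.2
      trans := fun r s t => h.trans r r.2 s s.2 t t.2
      trichotomous := fun r s hrs hsr => by
        by_contra hne
        exact (h.total r r.2 s s.2 fun h => hne (Subtype.ext h)).elim hrs hsr }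
  letI := Classical.decRel fun r s : D => lt r s
  linearOrderOfSTO fun r s : D => lt r s

/-- An interval free of boundary points of `X` lies in `X` as soon as it meets `X`, by the
intermediate value property. -/
theorem exists_interval_subset (h : IsOrderChart L Mb D lt)
    {X : Set Mt} (hX : DefinableSet L Mb X) (hf : (frontier X).Finite) {y : D} (hy : (y : Mt) ∈ X)
    (hyf : (y : Mt) ∉ frontier X) :
    letI := h.linearOrder
    ∃ I ∈ intervals ((↑) ⁻¹' frontier X : Set D), y ∈ I ∧ I ⊆ (↑) ⁻¹' X := by
  let _ := h.linearOrder
  obtain ⟨I, hI, hyI, hd⟩ := exists_mem_intervals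
    (hf.preimage Subtype.val_injective.injOn : ((↑) ⁻¹' frontier X : Set D).Finite) hyf
  have hconn := ordConnected_of_mem_intervals hI
  refine ⟨I, hI, hyI, fun w hw => ?_⟩
  by_contra hwX
  rcases lt_trichotomy y w with hyw | rfl | hyw
  · obtain ⟨z, hz, h1, h2, hzf⟩ := h.ivt y y.2 w w.2 hyw X hX hy hwX
    exact disjoint_left.1 hd (hconn.out hyI hw
      (⟨not_lt.1 h1, not_lt.1 h2⟩ : (⟨z, hz⟩ : D) ∈ Icc y w)) hzf
  · exact hwX hy
  · obtain ⟨z, hz, h1, h2, hzf⟩ := h.ivt w w.2 y y.2 hyw Xᶜ hX.compl hwX (not_not.2 hy)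
    rw [frontier_compl] at hzf
    exact disjoint_left.1 hd (hconn.out hw hyI
      (⟨not_lt.1 h1, not_lt.1 h2⟩ : (⟨z, hz⟩ : D) ∈ Icc w y)) hzf

theorem isOMinimal (h : IsOrderChart L Mb D lt) (hM : IsTTT (Mt := Mt) (Mb := Mb) φ)
    (hdim : IsOneDimensional L Mt Mb) : IsOMinimal L Mb D := by
  let _ := h.linearOrder
  refine ⟨inferInstance, ?_, ⟨?_⟩, ⟨?_⟩, ?_⟩
  · rw [definableRel_iff]
    have h1 : ∀ x : Fin 2 → Mt, (∃ (h₀ : x 0 ∈ D) (h₁ : x 1 ∈ D),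
        (⟨x 0, h₀⟩ : D) < ⟨x 1, h₁⟩) ↔ (x 0 ∈ D ∧ x 1 ∈ D) ∧ lt (x 0) (x 1) := by
      exact fun x => ⟨fun ⟨h₀, h₁, h⟩ => ⟨⟨h₀, h₁⟩, h⟩, fun ⟨⟨h₀, h₁⟩, h⟩ => ⟨h₀, h₁, h⟩⟩
    simp only [mem_ofPred_eq, h1]
    have hD := definableSet_iff.1 h.definable
    exact ((hD.comp (f := fun x : Fin 2 → Mt => x 0) (by fun_prop)).and
      (hD.comp (f := fun x : Fin 2 → Mt => x 1) (by fun_prop))).and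
      (h.definable_lt.comp (f := fun x : Fin 2 → Mt => (x 0, x 1)) (by fun_prop))
  · intro r s hrs
    by_contra hcon
    push Not at hcon
    obtain ⟨z, hz, h1, h2, hzf⟩ := h.ivt r r.2 s s.2 hrs {t ∈ D | lt t s}
      (definableSet_iff.2 ((definableSet_iff.1 h.definable).and
        (h.definable_lt.comp (f := fun t : Mt => (t, (s : Mt))) (by fun_prop))))
      ⟨r.2, hrs⟩ fun h' => h.irrefl s s.2 h'.2
    -- The lower ray of `s` is open, so its boundary point in `[r, s]` can only be `s`. The
    -- neighbourhood `(r, ∞)` of `s` then meets that ray, giving a point strictly between.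
    have hzs : (⟨z, hz⟩ : D) = s := by
      refine le_antisymm (not_lt.1 h2) (not_lt.1 fun h3 => hzf.2 ?_)
      rw [(h.isOpen_lower s s.2).interior_eq]
      exact ⟨hz, h3⟩
    obtain ⟨t, ht1, ht2⟩ := mem_closure_iff.1 hzf.1 _ (h.isOpen_upper r r.2)
      ⟨hz, (by rw [hzs]; exact hrs : r < (⟨z, hz⟩ : D))⟩
    exact (hcon ⟨t, ht1.1⟩ ht1.2).not_gt ht2.2
  · refine le_antisymm (le_generateFrom ?_) fun O hO => ?_
    · rintro _ ⟨a, rfl | rfl⟩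
      · convert (h.isOpen_upper a a.2).preimage continuous_subtype_val using 1
        ext t
        exact ⟨fun h => ⟨t.2, h⟩, fun h => h.2⟩
      · convert (h.isOpen_lower a a.2).preimage continuous_subtype_val using 1
        ext t
        exact ⟨fun h => ⟨t.2, h⟩, fun h => h.2⟩
    · rw [@isOpen_iff_forall_mem_open D (Preorder.topology D)]
      intro y hy
      obtain ⟨O', hO', rfl⟩ := isOpen_induced_iff.1 hO
      obtain ⟨V, hV, hyV, hVO⟩ := hM.isBasis.exists_subset_of_mem_open hy hO'
      have hVd := IsBasisSet.definableSet hV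
      obtain ⟨I, hI, hyI, hIV⟩ := h.exists_interval_subset hVd (hM.finite_frontier hdim hVd) hyV
        fun h' => h'.2 (by rwa [(hM.isOpen_of_isBasisSet hV).interior_eq])
      exact ⟨I, fun t ht => hVO (hIV ht),
        @isOpen_of_mem_intervals D _ (Preorder.topology D) (@OrderTopology.mk _ (_) _ rfl) _ _ hI, hyI⟩
  · intro X hXD hX
    have hf := hM.finite_frontier hdim hX
    set F : Set D := (↑) ⁻¹' frontier X with hF
    have hFf : F.Finite := hf.preimage Subtype.val_injective.injOn
    refine ⟨{I ∈ intervals F | I ⊆ (↑) ⁻¹' X} ∪ singleton '' (F ∩ (↑) ⁻¹' X),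
      ((finite_intervals hFf).subset (sep_subset _ _)).union ((hFf.inter_of_left _).image _), ?_, ?_⟩
    · rintro I (hI | ⟨a, -, rfl⟩)
      · exact isPointOrInterval_of_mem_intervals hI.1
      · exact .inl ⟨a, rfl⟩
    · refine Subset.antisymm (fun y hy => ?_) (sUnion_subset ?_)
      · by_cases hyf : y ∈ F
        · exact ⟨{y}, .inr ⟨y, ⟨hyf, hy⟩, rfl⟩, rfl⟩
        · obtain ⟨I, hI, hyI, hIX⟩ := h.exists_interval_subset hX hf hy hyf
          exact ⟨I, .inl ⟨hI, hIX⟩, hyI⟩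
      · rintro I (hI | ⟨a, ha, rfl⟩)
        · exact hI.2
        · exact singleton_subset_iff.2 ha.2

theorem restrict (h : IsOrderChart L Mb D lt) (hU : IsOpen U) (hUd : DefinableSet L Mb U)
    (hUD : U ⊆ D) (hconv : ∀ r ∈ U, ∀ s ∈ U, ∀ z ∈ D, lt r z → lt z s → z ∈ U) :
    IsOrderChart L Mb U lt where
  isOpen := hU
  definable := hUd
  definable_lt := h.definable_lt
  irrefl r hr := h.irrefl r (hUD hr)
  trans r hr s hs t ht := h.trans r (hUD hr) s (hUD hs) t (hUD ht)
  total r hr s hs := h.total r (hUD hr) s (hUD hs)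
  isOpen_lower r hr := by
    convert hU.inter (h.isOpen_lower r (hUD hr)) using 1
    ext s
    exact ⟨fun h => ⟨h.1, hUD h.1, h.2⟩, fun h => ⟨h.1, h.2.2⟩⟩
  isOpen_upper r hr := by
    convert hU.inter (h.isOpen_upper r (hUD hr)) using 1
    ext s
    exact ⟨fun h => ⟨h.1, hUD h.1, h.2⟩, fun h => ⟨h.1, h.2.2⟩⟩
  ivt r hr s hs hrs P hP hrP hsP := by
    obtain ⟨z, hz, h1, h2, hzf⟩ := h.ivt r (hUD hr) s (hUD hs) hrs P hP hrP hsP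
    refine ⟨z, ?_, h1, h2, hzf⟩
    by_cases hzr : z = r
    · exact hzr ▸ hr
    by_cases hzs : z = s
    · exact hzs ▸ hs
    exact hconv r hr s hs z hz ((h.total z hz r (hUD hr) hzr).resolve_left h1)
      ((h.total z hz s (hUD hs) hzs).resolve_right h2)

/-- A definably connected `U` is convex: a missing point `z` between two of its points would cut it
into two clopen pieces. -/
theorem restrict_of_compNum (h : IsOrderChart L Mb D lt) (hU : IsOpen U)
    (hUd : DefinableSet L Mb U) (hUD : U ⊆ D) (hc : compNum L Mb U = 1) :
    IsOrderChart L Mb U lt := by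
  refine h.restrict hU hUd hUD fun r hr s hs z hz hrz hzs => ?_
  by_contra hzU
  have hltd := definableSet_iff.2
    (h.definable_lt.comp (f := fun t : Mt => (t, z)) (by fun_prop))
  have hgtd := definableSet_iff.2
    (h.definable_lt.comp (f := fun t : Mt => (z, t)) (by fun_prop))
  have hlo : IsOpen ((↑) ⁻¹' {t ∈ D | lt t z} : Set U) :=
    (h.isOpen_lower z hz).preimage continuous_subtype_val
  have hup : IsOpen ((↑) ⁻¹' {t ∈ D | lt z t} : Set U) :=
    (h.isOpen_upper z hz).preimage continuous_subtype_val
  have hcompl : ((↑) ⁻¹' {t ∈ D | lt t z} : Set U)ᶜ = (↑) ⁻¹' {t ∈ D | lt z t} := by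
    ext t
    have htD := hUD t.2
    have htz : (t : Mt) ≠ z := fun h => hzU (h ▸ t.2)
    constructor
    · exact fun ht => ⟨htD, (h.total t htD z hz htz).resolve_left fun h => ht ⟨htD, h⟩⟩
    · exact fun ht ht' => h.irrefl z hz (h.trans z hz t htD z hz ht.2 ht'.2)
  have hpart : IsClopenPartition L Mb U ![U ∩ {t | lt t z}, U ∩ {t | lt z t}] := by
    have e1 : ((↑) ⁻¹' (U ∩ {t | lt t z}) : Set U) = (↑) ⁻¹' {t ∈ D | lt t z} := by
      ext t; exact ⟨fun h => ⟨hUD t.2, h.2⟩, fun h => ⟨t.2, h.2⟩⟩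
    have e2 : ((↑) ⁻¹' (U ∩ {t | lt z t}) : Set U) = (↑) ⁻¹' {t ∈ D | lt z t} := by
      ext t; exact ⟨fun h => ⟨hUD t.2, h.2⟩, fun h => ⟨t.2, h.2⟩⟩
    have hdis : Disjoint (U ∩ {t | lt t z}) (U ∩ {t | lt z t}) := disjoint_left.2
      fun t ht ht' => h.irrefl z hz (h.trans z hz t (hUD ht.1) z hz ht'.2 ht.2)
    refine ⟨?_, ?_, ?_, ?_, ?_⟩
    · exact Fin.forall_fin_two.2 ⟨⟨r, hr, hrz⟩, ⟨s, hs, hzs⟩⟩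
    · exact Fin.forall_fin_two.2 ⟨hUd.inter hltd, hUd.inter hgtd⟩
    · refine Fin.forall_fin_two.2 ⟨?_, ?_⟩
      · change IsClopen (_ ⁻¹' (U ∩ {t | lt t z}))
        rw [e1]
        exact ⟨⟨hcompl ▸ hup⟩, hlo⟩
      · change IsClopen (_ ⁻¹' (U ∩ {t | lt z t}))
        rw [e2, ← hcompl]
        exact ⟨hlo.isClosed_compl, hcompl ▸ hup⟩
    · intro i j
      fin_cases i <;> fin_cases j
      · exact fun h => (h rfl).elim
      · exact fun _ => hdis
      · exact fun _ => hdis.symm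
      · exact fun h => (h rfl).elim
    · ext t
      rw [mem_iUnion, Fin.exists_fin_two]
      constructor
      · rintro (h | h) <;> exact h.1
      · intro ht
        exact (h.total t (hUD ht) z hz fun h => hzU (h ▸ ht)).imp (⟨ht, ·⟩) (⟨ht, ·⟩)
  have h2 : ((2 : ℕ) : ℕ∞) ≤ compNum L Mb U := le_iSup₂_of_le 2 ⟨_, hpart⟩ le_rfl
  rw [hc] at h2
  exact absurd h2 (by norm_num)

end IsOrderChart

end Charts

end TTT

namespace TTT

open Filter Topology

/-! ### One-sided charts -/

/-- A definable family of open sets `A r` with boundary points `x` and `r`, which have the same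
germ at `x`; it should be thought of as a family of intervals `(x, r)`. -/
structure IsHalfChart (L : FirstOrder.Language.{u, v}) {Mt : Type w} (Mb : Type w')
    [L.Structure (Mt ⊕ Mb)] [Fact (IsTwoSorted L Mt Mb)] [TopologicalSpace Mt] (x : Mt)
    (R : Set Mt) (A : Mt → Set Mt) : Prop where
  definable_rel : DefPred L (Mt ⊕ Mb) fun p : Mt × Mt => p.2 ∈ A p.1
  isOpen : ∀ r ∈ R, IsOpen (A r)
  frontier_eq : ∀ r ∈ R, frontier (A r) = {x, r}
  base_notMem : x ∉ R
  germ : ∀ r ∈ R, ∀ t ∈ R, x ∉ closure (A r \ A t)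
  eq_empty : ∀ r ∈ R, ∀ t ∈ R, ∀ Y ⊆ A r ∪ A t, IsOpen Y → DefinableSet L Mb Y →
    frontier Y ⊆ {x} → Y = ∅

section

variable {L : FirstOrder.Language.{u, v}} {Mt : Type w} {Mb : Type w'} [L.Structure (Mt ⊕ Mb)]
variable [Fact (IsTwoSorted L Mt Mb)] [TopologicalSpace Mt] {k : ℕ} {φ : L.Formula (Fin 1 ⊕ Fin k)}
variable {x : Mt} {R R' : Set Mt} {A B : Mt → Set Mt} {r s t t' : Mt}

namespace IsHalfChart

theorem definableSet (h : IsHalfChart L Mb x R A) (r : Mt) : DefinableSet L Mb (A r) :=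
  definableSet_iff.2 (h.definable_rel.comp (f := fun y : Mt => (r, y)) (by fun_prop))

theorem notMem_of_mem_frontier (h : IsHalfChart L Mb x R A) (hr : r ∈ R) {z : Mt}
    (hz : z = x ∨ z = r) : z ∉ A r := by
  have : z ∈ frontier (A r) := by rw [h.frontier_eq r hr]; exact hz
  rw [(h.isOpen r hr).frontier_eq] at this
  exact this.2

theorem mem_closure_iff (h : IsHalfChart L Mb x R A) (hr : r ∈ R) {z : Mt} :
    z ∈ closure (A r) ↔ z ∈ A r ∨ z = x ∨ z = r := by
  rw [closure_eq_self_union_frontier, h.frontier_eq r hr]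
  rfl

theorem ne_base (h : IsHalfChart L Mb x R A) (hr : r ∈ R) : r ≠ x :=
  fun e => h.base_notMem (e ▸ hr)

theorem inter_nonempty (h : IsHalfChart L Mb x R A) (hr : r ∈ R) (ht : t ∈ R) :
    (A r ∩ A t).Nonempty := by
  have h1 : x ∈ closure (A r) := (h.mem_closure_iff hr).2 (.inr (.inl rfl))
  rw [← inter_union_sdiff (A r) (A t), closure_union] at h1
  exact closure_nonempty_iff.1 ⟨x, h1.resolve_right (h.germ r hr t ht)⟩

/-- Otherwise the nonempty open set `A r ∩ A t` would have no boundary point other than `x`. -/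
theorem total (h : IsHalfChart L Mb x R A) (hr : r ∈ R) (ht : t ∈ R) (hne : r ≠ t) :
    r ∈ A t ∨ t ∈ A r := by
  by_contra hcon
  obtain ⟨h1, h2⟩ := not_or.1 hcon
  have ho := (h.isOpen r hr).inter (h.isOpen t ht)
  refine (h.inter_nonempty hr ht).ne_empty (h.eq_empty r hr t ht _
    (inter_subset_left.trans subset_union_left) ho
    ((h.definableSet r).inter (h.definableSet t)) fun z hz => ?_)
  rw [ho.frontier_eq] at hz
  have z1 := (h.mem_closure_iff hr).1 (closure_mono inter_subset_left hz.1)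
  have z2 := (h.mem_closure_iff ht).1 (closure_mono inter_subset_right hz.1)
  have hz3 := hz.2
  have := h.ne_base hr
  have := h.ne_base ht
  rw [mem_inter_iff] at hz3
  rw [mem_singleton_iff]
  grind

/-- Otherwise `A r ∪ A t` would absorb both `r` and `t`, leaving only `x` on its boundary. -/
theorem asymm (h : IsHalfChart L Mb x R A) (hr : r ∈ R) (ht : t ∈ R) (hrt : r ∈ A t) :
    t ∉ A r := by
  intro htr
  have ho := (h.isOpen r hr).union (h.isOpen t ht)
  refine (Nonempty.mono subset_union_right ⟨r, hrt⟩).ne_empty (h.eq_empty r hr t ht _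
    subset_rfl ho ((h.definableSet r).union (h.definableSet t)) fun z hz => ?_)
  rw [ho.frontier_eq, closure_union] at hz
  have z1 := h.mem_closure_iff hr (z := z)
  have z2 := h.mem_closure_iff ht (z := z)
  obtain ⟨hz1, hz2⟩ := hz
  rw [mem_union] at hz1 hz2
  rw [mem_singleton_iff]
  grind

/-- Only `x` can be on the boundary of `A r \ closure (A t)`, so that set is empty. This inclusion
is transitivity of the order. -/
theorem subset (h : IsHalfChart L Mb x R A) (hr : r ∈ R) (ht : t ∈ R) (hrt : r ∈ A t) :
    A r ⊆ A t := by
  have htr := h.asymm hr ht hrt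
  have ho := (h.isOpen r hr).sdiff (isClosed_closure (s := A t))
  have hsub : A r \ closure (A t) ⊆ A r \ A t := sdiff_subset_sdiff_right subset_closure
  have he : A r \ closure (A t) = ∅ := by
    have hd : A r \ closure (A t) = A r \ (A t ∪ {x, t}) := by
      rw [closure_eq_self_union_frontier, h.frontier_eq t ht]
    refine h.eq_empty r hr t ht _ (sdiff_subset.trans subset_union_left) ho ?_ fun z hz => ?_
    · rw [hd]
      exact (h.definableSet r).diff ((h.definableSet t).union
        (.of_finite ((finite_singleton t).insert x)))
    rw [ho.frontier_eq] at hz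
    have z1 := (h.mem_closure_iff hr).1 (closure_mono sdiff_subset hz.1)
    have z2 : z ∉ A t := fun hzt => by
      obtain ⟨y, hy, hy'⟩ := _root_.mem_closure_iff.1 (closure_mono hsub hz.1) _ (h.isOpen t ht) hzt
      exact hy'.2 hy
    have z3 := h.mem_closure_iff ht (z := z)
    have z4 := hz.2
    rw [Set.mem_sdiff] at z4
    rw [mem_singleton_iff]
    grind
  intro y hy
  have hy1 := (h.mem_closure_iff ht).1 (sdiff_eq_empty.1 he hy)
  have := h.notMem_of_mem_frontier hr (.inl rfl)
  grind

/-- Common core of both intermediate value statements. `G` is the initial segment on which nothing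
is assumed about `P`: it is `A r` when starting from `r`, and empty when starting from `x`. If `P`
has no boundary point beyond `G`, then `G ∪ (interior P ∩ A r)` contradicts rigidity. -/
theorem ivt_aux (h : IsHalfChart L Mb x R A) (hM : IsTTT (Mt := Mt) (Mb := Mb) φ) (hr : r ∈ R)
    {G P : Set Mt} (hGo : IsOpen G) (hGd : DefinableSet L Mb G) (hG : G ⊆ A r)
    (hP : DefinableSet L Mb P) (hrP : r ∉ closure P) (hrG : r ∉ closure G)
    (hz : ∀ z ∈ A r, z ∉ G → z ∉ frontier P ∧ (z ∈ closure G → z ∈ P))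
    (hne : (G ∪ (interior P ∩ A r)).Nonempty) : False := by
  have ho := hGo.union (isOpen_interior.inter (h.isOpen r hr) : IsOpen (interior P ∩ A r))
  have hsub : G ∪ (interior P ∩ A r) ⊆ A r := union_subset hG inter_subset_right
  refine hne.ne_empty (h.eq_empty r hr r hr _ (hsub.trans subset_union_left) ho
    (hGd.union ((hM.definableSet_interior hP).inter (h.definableSet r))) fun z hzf => ?_)
  rw [ho.frontier_eq] at hzf
  have z1 := (h.mem_closure_iff hr).1 (closure_mono hsub hzf.1)
  have z2 : z ∈ closure G ∪ closure P := by
    rw [← closure_union]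
    exact closure_mono (union_subset_union_right _ (inter_subset_left.trans interior_subset)) hzf.1
  have z3 := hzf.2
  have z4 : z ∈ P → z ∈ closure P := fun h => subset_closure h
  have z5 : z ∈ frontier P ↔ z ∈ closure P ∧ z ∉ interior P := Iff.rfl
  have z6 := hz z
  rw [mem_union] at z2 z3
  rw [mem_inter_iff] at z3
  rw [mem_singleton_iff]
  grind

theorem ivt (h : IsHalfChart L Mb x R A) (hM : IsTTT (Mt := Mt) (Mb := Mb) φ) (hr : r ∈ R)
    (ht : t ∈ R) (hrt : r ∈ A t) {P : Set Mt} (hP : DefinableSet L Mb P) (hrP : r ∈ P)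
    (htP : t ∉ P) : ∃ z ∈ frontier P, (z ∈ A t ∧ z ∉ A r) ∨ z = t := by
  by_contra hcon
  push Not at hcon
  have htf : t ∉ closure P := fun h' => (hcon t ⟨h', fun h'' => htP (interior_subset h'')⟩).2 rfl
  have hx : x ∉ A t := h.notMem_of_mem_frontier ht (.inl rfl)
  refine h.ivt_aux hM ht (h.isOpen r hr) (h.definableSet r) (h.subset hr ht hrt) hP htf ?_
    (fun z hz hzr => ⟨fun hzf => hzr ((hcon z hzf).1 hz), fun hzc => ?_⟩)
    ((h.inter_nonempty hr hr).mono (inter_subset_left.trans subset_union_left))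
  · rw [h.mem_closure_iff hr]
    have h1 := h.asymm hr ht hrt
    have h2 := h.ne_base ht
    have h3 : t ∉ A t := h.notMem_of_mem_frontier ht (.inr rfl)
    grind
  · rw [h.mem_closure_iff hr] at hzc
    grind

theorem ivt_base (h : IsHalfChart L Mb x R A) (hM : IsTTT (Mt := Mt) (Mb := Mb) φ)
    (ht : t ∈ R) {P : Set Mt} (hP : DefinableSet L Mb P) (hxP : x ∈ P)
    (htP : t ∉ P) : ∃ z ∈ frontier P, z ∈ A t ∨ z = t ∨ z = x := by
  by_contra hcon
  push Not at hcon
  have htf : t ∉ closure P := fun h' => (hcon t ⟨h', fun h'' => htP (interior_subset h'')⟩).2.1 rfl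
  refine h.ivt_aux hM ht isOpen_empty .empty (empty_subset _) hP htf (by simp)
    (fun z hz _ => ⟨fun hzf => (hcon z hzf).1 hz, by simp⟩) ?_
  have hxi : x ∈ interior P := by
    by_contra h'
    exact (hcon x ⟨subset_closure hxP, h'⟩).2.2 rfl
  rw [empty_union]
  exact _root_.mem_closure_iff.1 ((h.mem_closure_iff ht).2 (.inr (.inl rfl))) _ isOpen_interior hxi

theorem isOpen_outer (h : IsHalfChart L Mb x R A) (ht : t ∈ R) (htR : A t ⊆ R) (hr : r ∈ A t) :
    IsOpen {s ∈ A t | r ∈ A s} := by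
  convert (h.isOpen t ht).sdiff (isClosed_closure (s := A r)) using 1
  ext s
  rw [Set.mem_sdiff, h.mem_closure_iff (htR hr), mem_ofPred_eq, and_congr_right_iff]
  intro hs
  have h1 := h.asymm (htR hr) (htR hs)
  have h2 := h.total (htR hr) (htR hs)
  have h3 := h.ne_base (htR hs)
  have h4 : r ∉ A r := h.notMem_of_mem_frontier (htR hr) (.inr rfl)
  grind

/-- Replacing `A t` by `A r` keeps a neighbourhood of `x`, because the two have the same germ there.
-/
theorem isOpen_inner (h : IsHalfChart L Mb x R A) (ht : t ∈ R) (htR : A t ⊆ R) (hr : r ∈ A t)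
    {E : Set Mt} (hE : IsOpen E) (hD : IsOpen ({x} ∪ A t ∪ E)) : IsOpen ({x} ∪ A r ∪ E) := by
  have : {x} ∪ A r ∪ E = (({x} ∪ A t ∪ E) \ closure (A t \ A r)) ∪ A r ∪ E := by
    have h1 := h.subset (htR hr) ht hr
    have h2 := h.germ t ht r (htR hr)
    have h3 : A t \ A r ⊆ closure (A t \ A r) := subset_closure
    ext s
    have h4 := @h1 s
    have h5 := @h3 s
    simp only [mem_union, Set.mem_sdiff, mem_singleton_iff] at h5 ⊢
    grind
  rw [this]
  exact ((hD.sdiff isClosed_closure).union (h.isOpen r (htR hr))).union hE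

/-- `A t` is placed above `x` and `B t'` below it with reversed order: for `r`, `s` in `B t'`, `s ∈
B r` says that `s` is nearer to `x`, hence larger. -/
theorem isOrderChart (h : IsHalfChart L Mb x R A) (h' : IsHalfChart L Mb x R' B)
    (hM : IsTTT (Mt := Mt) (Mb := Mb) φ) (ht : t ∈ R)
    (htR : A t ⊆ R) (ht' : t' ∈ R') (htR' : B t' ⊆ R') (hdis : Disjoint (A t) (B t'))
    (ho : IsOpen ({x} ∪ A t ∪ B t')) :
    IsOrderChart L Mb ({x} ∪ A t ∪ B t') fun r s =>
      (r ∈ B t' ∧ (s ∈ B r ∨ s ∉ B t')) ∨ (s ∈ A t ∧ (r ∈ A s ∨ r = x)) := by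
  have hxA : x ∉ A t := h.notMem_of_mem_frontier ht (.inl rfl)
  have hxB : x ∉ B t' := h'.notMem_of_mem_frontier ht' (.inl rfl)
  have hAB : ∀ z, z ∈ A t → z ∉ B t' := fun _ hz => disjoint_left.1 hdis hz
  have subA : ∀ s ∈ A t, ∀ z ∈ A s, z ∈ A t := fun s hs => h.subset (htR hs) ht hs
  have subB : ∀ s ∈ B t', ∀ z ∈ B s, z ∈ B t' := fun s hs => h'.subset (htR' hs) ht' hs
  have trA : ∀ s ∈ A t, ∀ r ∈ A s, ∀ z ∈ A r, z ∈ A s := fun s hs r hr =>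
    h.subset (htR (subA s hs r hr)) (htR hs) hr
  have trB : ∀ s ∈ B t', ∀ r ∈ B s, ∀ z ∈ B r, z ∈ B s := fun s hs r hr =>
    h'.subset (htR' (subB s hs r hr)) (htR' hs) hr
  have irA : ∀ s ∈ A t, s ∉ A s := fun s hs => h.notMem_of_mem_frontier (htR hs) (.inr rfl)
  have irB : ∀ s ∈ B t', s ∉ B s := fun s hs => h'.notMem_of_mem_frontier (htR' hs) (.inr rfl)
  have totA : ∀ s ∈ A t, ∀ r ∈ A t, s ≠ r → s ∈ A r ∨ r ∈ A s := fun s hs r hr =>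
    h.total (htR hs) (htR hr)
  have totB : ∀ s ∈ B t', ∀ r ∈ B t', s ≠ r → s ∈ B r ∨ r ∈ B s := fun s hs r hr =>
    h'.total (htR' hs) (htR' hr)
  have hoA := h.isOpen t ht
  have hoB := h'.isOpen t' ht'
  have ho' : IsOpen ({x} ∪ B t' ∪ A t) := by rwa [union_right_comm]
  have memD : ∀ z, z ∈ {x} ∪ A t ∪ B t' ↔ (z = x ∨ z ∈ A t) ∨ z ∈ B t' := fun z => Iff.rfl
  refine ⟨ho, ?_, ?_, ?_, ?_, ?_, ?_, ?_, ?_⟩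
  · exact ((DefinableSet.singleton x).union (h.definableSet t)).union (h'.definableSet t')
  · have dA := definableSet_iff.1 (h.definableSet t)
    have dB := definableSet_iff.1 (h'.definableSet t')
    refine (dB.fst.and (h'.definable_rel.or dB.snd.not)).or (dA.snd.and (DefPred.or ?_ ?_))
    · exact h.definable_rel.comp (f := fun p : Mt × Mt => (p.2, p.1)) (by fun_prop)
    · exact DefPred.eq (f := fun p : Mt × Mt => p.1) (by fun_prop) (by fun_prop)
  · intro r hr
    rw [memD] at hr
    grind
  · intro r hr s hs u hu
    rw [memD] at hr hs hu
    grind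
  · intro r hr s hs
    rw [memD] at hr hs
    grind
  · intro r hr
    rcases hr with (hr | hr) | hr
    · obtain rfl : r = x := hr
      convert hoB using 1
      ext s
      rw [mem_ofPred_eq, memD]
      grind
    · convert h.isOpen_inner ht htR hr hoB ho using 1
      ext s
      simp only [mem_ofPred_eq, mem_union, mem_singleton_iff]
      grind
    · convert h'.isOpen_outer ht' htR' hr using 1
      ext s
      rw [mem_ofPred_eq, mem_ofPred_eq, memD]
      grind
  · intro r hr
    rcases hr with (hr | hr) | hr
    · obtain rfl : r = x := hr
      convert hoA using 1
      ext s
      rw [mem_ofPred_eq, memD]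
      grind
    · convert h.isOpen_outer ht htR hr using 1
      ext s
      rw [mem_ofPred_eq, mem_ofPred_eq, memD]
      grind
    · convert h'.isOpen_inner ht' htR' hr hoA ho' using 1
      ext s
      simp only [mem_ofPred_eq, mem_union, mem_singleton_iff]
      grind
  · intro r hr s hs hrs P hP hrP hsP
    have baseA : s ∈ A t → x ∈ P → ∃ z ∈ frontier P, z ∈ A s ∨ z = s ∨ z = x := fun hs hx =>
      h.ivt_base hM (htR hs) hP hx hsP
    have baseB : r ∈ B t' → x ∉ P → ∃ z ∈ frontier P, z ∈ B r ∨ z = r ∨ z = x := fun hr hx => by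
      simpa only [frontier_compl] using
        h'.ivt_base hM (htR' hr) hP.compl hx (not_not.2 hrP)
    have innerA : s ∈ A t → r ∈ A s → ∃ z ∈ frontier P, (z ∈ A s ∧ z ∉ A r) ∨ z = s :=
      fun hs hr => h.ivt hM (htR (subA s hs r hr)) (htR hs) hr hP hrP hsP
    have innerB : r ∈ B t' → s ∈ B r → ∃ z ∈ frontier P, (z ∈ B r ∧ z ∉ B s) ∨ z = r :=
      fun hr hs => by
        simpa only [frontier_compl] using
          h'.ivt hM (htR' (subB r hr s hs)) (htR' hr) hs hP.compl hsP (not_not.2 hrP)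
    -- If `r` and `s` are on opposite sides of `x`, membership in `P` changes between `x` and one of
    -- them; which one depends on whether `x ∈ P`.
    have key : ∃ z ∈ frontier P, (s ∈ A t ∧ r ∉ A t ∧ (z ∈ A s ∨ z = s ∨ z = x)) ∨
        (r ∈ B t' ∧ s ∉ B t' ∧ (z ∈ B r ∨ z = r ∨ z = x)) ∨
        (s ∈ A t ∧ r ∈ A s ∧ ((z ∈ A s ∧ z ∉ A r) ∨ z = s)) ∨
        (r ∈ B t' ∧ s ∈ B r ∧ ((z ∈ B r ∧ z ∉ B s) ∨ z = r)) := by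
      rw [memD] at hr hs
      by_cases hx : x ∈ P <;> grind
    obtain ⟨z, hzf, hz⟩ := key
    refine ⟨z, ?_, ?_, ?_, hzf⟩
    · rw [memD]
      grind
    · rw [memD] at hr hs
      grind
    · rw [memD] at hr hs
      grind

end IsHalfChart

end

end TTT

namespace TTT

open Filter Topology

/-! ### Local behaviour of sets at a point, and gluing two half charts -/

section

variable {α : Type*} [TopologicalSpace α]

theorem notMem_frontier_iff_eventually {X : Set α} {y : α} :
    y ∉ frontier X ↔ ∀ᶠ p in 𝓝 y, (p ∈ X ↔ y ∈ X) := by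
  rw [frontier_eq_closure_inter_closure, mem_inter_iff, not_and_or, mem_closure_iff_frequently,
    mem_closure_iff_frequently, not_frequently, not_frequently]
  by_cases hy : y ∈ X
  · simp only [hy, iff_true, mem_compl_iff, not_not]
    refine or_iff_right_of_imp fun h => ?_
    exact (h.self_of_nhds hy).elim
  · simp only [hy, iff_false, mem_compl_iff, not_not]
    refine or_iff_left_of_imp fun h => ?_
    exact (hy h.self_of_nhds).elim

theorem mem_closure_diff_singleton_iff_frequently {X : Set α} {y : α} :
    y ∈ closure (X \ {y}) ↔ ∃ᶠ p in 𝓝[≠] y, p ∈ X := by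
  rw [mem_closure_iff_frequently, frequently_nhdsWithin_iff]
  rfl

theorem Splits.not_isOpen_singleton {Z : Set α} {x : α} (h : Splits Z x) :
    ¬ IsOpen ({x} : Set α) := by
  intro ho
  obtain ⟨y, hy, hy'⟩ := mem_closure_iff.1 h.1 _ ho rfl
  exact hy'.2 hy

end

variable {L : FirstOrder.Language.{u, v}} {Mt : Type w} {Mb : Type w'} [L.Structure (Mt ⊕ Mb)]
variable [Fact (IsTwoSorted L Mt Mb)] [TopologicalSpace Mt] {k : ℕ} {φ : L.Formula (Fin 1 ⊕ Fin k)}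

theorem IsHalfChart.exists_isOrderChart {x t t' : Mt} {R R' : Set Mt} {A B : Mt → Set Mt}
    (h : IsHalfChart L Mb x R A) (h' : IsHalfChart L Mb x R' B)
    (hM : IsTTT (Mt := Mt) (Mb := Mb) φ) (ht : t ∈ R)
    (htR : A t ⊆ R) (ht' : t' ∈ R') (htR' : B t' ⊆ R') (hdis : Disjoint (A t) (B t'))
    (hev : ∀ᶠ y in 𝓝[≠] x, y ∈ A t ∨ y ∈ B t') :
    ∃ (D : Set Mt) (lt : Mt → Mt → Prop), IsOrderChart L Mb D lt ∧ x ∈ D ∧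
      (∃ d ∈ D, lt d x) ∧ ∃ d ∈ D, lt x d := by
  have ho : IsOpen ({x} ∪ A t ∪ B t') := by
    rw [isOpen_iff_mem_nhds]
    rintro y ((hy | hy) | hy)
    · obtain rfl : y = x := hy
      rw [eventually_nhdsWithin_iff] at hev
      filter_upwards [hev] with p hp
      by_cases hpy : p = y
      · exact .inl (.inl hpy)
      · exact (hp hpy).imp .inr id
    · exact mem_of_superset ((h.isOpen t ht).mem_nhds hy) fun p hp => .inl (.inr hp)
    · exact mem_of_superset ((h'.isOpen t' ht').mem_nhds hy) fun p hp => .inr hp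
  obtain ⟨d, hd, -⟩ := h.inter_nonempty ht ht
  obtain ⟨d', hd', -⟩ := h'.inter_nonempty ht' ht'
  refine ⟨_, _, h.isOrderChart h' hM ht htR ht' htR' hdis ho, .inl (.inl rfl),
    ⟨d', .inr hd', .inl ⟨hd', .inr ?_⟩⟩, ⟨d, .inl (.inr hd), .inr ⟨hd, .inr rfl⟩⟩⟩
  exact h'.notMem_of_mem_frontier ht' (.inl rfl)

/-! ### Charts from moving sets -/

/-- A definable family of sets `Q r` which, inside the open set `W`, has no boundary points other
than `r`, depends continuously on `r` at `z`, and for which `Q z` splits `z`. -/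
structure IsMovingFamily (L : FirstOrder.Language.{u, v}) {Mt : Type w} (Mb : Type w')
    [L.Structure (Mt ⊕ Mb)] [Fact (IsTwoSorted L Mt Mb)] [TopologicalSpace Mt] (z : Mt)
    (Q : Mt → Set Mt) (W : Set Mt) : Prop where
  definable_rel : DefPred L (Mt ⊕ Mb) fun p : Mt × Mt => p.2 ∈ Q p.1
  splits : Splits (Q z) z
  isOpen : IsOpen W
  mem : z ∈ W
  eq_of_mem_frontier : ∀ r ∈ W, ∀ y ∈ W, y ∈ frontier (Q r) → y = r
  eventually_iff : ∀ q ∈ W, q ≠ z → ∀ᶠ r in 𝓝 z, (q ∈ Q r ↔ q ∈ Q z)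
  eq_empty : ∀ Y ⊆ W, IsOpen Y → DefinableSet L Mb Y → frontier Y ⊆ {z} → Y = ∅

/-- The part in `N` of the symmetric difference of `Q r` and `Q z`. -/
def movedSet {Mt : Type w} (z : Mt) (Q : Mt → Set Mt) (N : Set Mt) (r : Mt) : Set Mt :=
  {y | (y ∈ N ∧ ¬ (y ∈ Q r ↔ y ∈ Q z)) ∧ y ≠ r ∧ y ≠ z}

/-- The points `r` of `N` for which `Q r` and `Q z` agree on the boundary of `N`. -/
def smallMoves {Mt : Type w} [TopologicalSpace Mt] (z : Mt) (Q : Mt → Set Mt) (N : Set Mt) :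
    Set Mt :=
  {r | r ∈ N ∧ r ≠ z ∧ ∀ q ∈ frontier N, (q ∈ Q r ↔ q ∈ Q z)}

namespace IsMovingFamily

variable {z : Mt} {Q : Mt → Set Mt} {W N N₁ : Set Mt} {r t : Mt}

theorem definableSet (h : IsMovingFamily L Mb z Q W) (r : Mt) : DefinableSet L Mb (Q r) :=
  definableSet_iff.2 (h.definable_rel.comp (f := fun y : Mt => (r, y)) (by fun_prop))

theorem definable_movedSet (h : IsMovingFamily L Mb z Q W) (hN : DefinableSet L Mb N) :
    DefPred L (Mt ⊕ Mb) fun p : Mt × Mt => p.2 ∈ movedSet z Q N p.1 := by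
  have hz := definableSet_iff.1 (h.definableSet z)
  exact ((definableSet_iff.1 hN).snd.and (h.definable_rel.iff hz.snd).not).and
    ((DefPred.eq (f := fun p : Mt × Mt => p.2) (by fun_prop) (by fun_prop)).not.and
      (DefPred.eq (f := fun p : Mt × Mt => p.2) (by fun_prop) (by fun_prop)).not)

theorem definableSet_movedSet (h : IsMovingFamily L Mb z Q W) (hN : DefinableSet L Mb N) (r : Mt) :
    DefinableSet L Mb (movedSet z Q N r) :=
  definableSet_iff.2 ((h.definable_movedSet hN).comp (f := fun y : Mt => (r, y)) (by fun_prop))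

theorem eventually_mem (h : IsMovingFamily L Mb z Q W) {y : Mt} (hr : r ∈ W) (hy : y ∈ W)
    (hne : y ≠ r) : ∀ᶠ p in 𝓝 y, (p ∈ Q r ↔ y ∈ Q r) :=
  notMem_frontier_iff_eventually.1 fun hf => hne (h.eq_of_mem_frontier r hr y hy hf)

theorem isOpen_movedSet [T2Space Mt] (h : IsMovingFamily L Mb z Q W) (hN : IsOpen N) (hNW : N ⊆ W)
    (hr : r ∈ N) : IsOpen (movedSet z Q N r) := by
  rw [isOpen_iff_mem_nhds]
  rintro y ⟨⟨hyN, hyQ⟩, hyr, hyz⟩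
  filter_upwards [hN.mem_nhds hyN, h.eventually_mem (hNW hr) (hNW hyN) hyr,
    h.eventually_mem h.mem (hNW hyN) hyz, isOpen_ne.mem_nhds hyr, isOpen_ne.mem_nhds hyz]
    with p h1 h2 h3 h4 h5
  exact ⟨⟨h1, by rwa [h2, h3]⟩, h4, h5⟩

/-- If `Q r` agreed with `Q z` around `z`, it would also split `z`, making `z` a boundary point of
`Q r` other than `r`. -/
theorem mem_closure_movedSet [T2Space Mt] (h : IsMovingFamily L Mb z Q W) (hN : IsOpen N)
    (hz : z ∈ N) (hNW : N ⊆ W) (hr : r ∈ N) (hrz : r ≠ z) : z ∈ closure (movedSet z Q N r) := by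
  by_contra hcon
  rw [mem_closure_iff_frequently, not_frequently] at hcon
  have hev : ∀ᶠ p in 𝓝[≠] z, (p ∈ Q r ↔ p ∈ Q z) := by
    rw [eventually_nhdsWithin_iff]
    filter_upwards [hcon, hN.mem_nhds hz, isOpen_ne.mem_nhds hrz.symm] with p h1 h2 h3 h4
    by_contra h5
    exact h1 ⟨⟨h2, h5⟩, h3, h4⟩
  have h1 : z ∈ closure (Q r) := closure_mono sdiff_subset
    (mem_closure_diff_singleton_iff_frequently.2
      (((mem_closure_diff_singleton_iff_frequently.1 h.splits.1).and_eventually hev).mono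
        fun p hp => hp.2.2 hp.1))
  have h2 : z ∈ closure (Q r)ᶜ := closure_mono sdiff_subset
    (mem_closure_diff_singleton_iff_frequently.2
      (((mem_closure_diff_singleton_iff_frequently.1 h.splits.2).and_eventually hev).mono
        fun p hp hp' => hp.1 (hp.2.1 hp')))
  refine hrz (h.eq_of_mem_frontier r (hNW hr) z h.mem ?_).symm
  rw [frontier_eq_closure_inter_closure]
  exact ⟨h1, h2⟩

/-- Away from `z` and `r`, both `Q z` and `Q r` are locally constant, and for small moves they agree
on the boundary of `N`. -/
theorem frontier_movedSet_subset [T2Space Mt] (h : IsMovingFamily L Mb z Q W) (hN : IsOpen N)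
    (hNW : closure N ⊆ W) (hr : r ∈ smallMoves z Q N) :
    frontier (movedSet z Q N r) ⊆ {z, r} := by
  intro y hy
  rw [(h.isOpen_movedSet hN (subset_closure.trans hNW) hr.1).frontier_eq] at hy
  by_contra hcon
  obtain ⟨hyz, hyr⟩ : y ≠ z ∧ y ≠ r := not_or.1 hcon
  have hyN : y ∈ closure N := closure_mono (fun p hp => hp.1.1) hy.1
  have hrW : r ∈ W := hNW (subset_closure hr.1)
  have hyQ : ¬ (y ∈ Q r ↔ y ∈ Q z) := by
    obtain ⟨p, hp, h1, h2⟩ := ((mem_closure_iff_frequently.1 hy.1).and_eventually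
      ((h.eventually_mem hrW (hNW hyN) hyr).and (h.eventually_mem h.mem (hNW hyN) hyz))).exists
    have := hp.1.2
    rwa [h1, h2] at this
  by_cases hyN' : y ∈ N
  · exact hy.2 ⟨⟨hyN', hyQ⟩, hyr, hyz⟩
  · exact hyQ (hr.2.2 y (by rw [hN.frontier_eq]; exact ⟨hyN, hyN'⟩))

theorem frontier_movedSet [T2Space Mt] (h : IsMovingFamily L Mb z Q W) (hN : IsOpen N)
    (hNd : DefinableSet L Mb N) (hz : z ∈ N) (hNW : closure N ⊆ W) (hr : r ∈ smallMoves z Q N) :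
    frontier (movedSet z Q N r) = {z, r} := by
  have hNW' := subset_closure.trans hNW
  have ho := h.isOpen_movedSet hN hNW' hr.1
  have hzc := h.mem_closure_movedSet hN hz hNW' hr.1 hr.2.1
  have hsub := h.frontier_movedSet_subset hN hNW hr
  refine hsub.antisymm (insert_subset ?_ (singleton_subset_iff.2 ?_))
  · rw [ho.frontier_eq]
    exact ⟨hzc, fun h' => h'.2.2 rfl⟩
  · by_contra hcon
    have := h.eq_empty (movedSet z Q N r) (fun p hp => hNW' hp.1.1) ho
      (h.definableSet_movedSet hNd r) fun y hy => (hsub hy).resolve_right fun e => hcon (e ▸ hy)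
    rw [this, closure_empty] at hzc
    exact hzc

/-- The proposition `p` selects the side. Near `z`, membership in `Q r` is constantly `p`, so the
germ at `z` of the moved set depends on `p` alone. -/
theorem isHalfChart [T2Space Mt] (h : IsMovingFamily L Mb z Q W) (hN : IsOpen N)
    (hNd : DefinableSet L Mb N) (hz : z ∈ N) (hNW : closure N ⊆ W) (p : Prop) :
    IsHalfChart L Mb z {r ∈ smallMoves z Q N | z ∈ Q r ↔ p} (movedSet z Q N) where
  definable_rel := h.definable_movedSet hNd
  isOpen r hr := h.isOpen_movedSet hN (subset_closure.trans hNW) hr.1.1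
  frontier_eq r hr := h.frontier_movedSet hN hNd hz hNW hr.1
  base_notMem hz' := hz'.1.2.1 rfl
  germ r hr t ht := by
    have hNW' := subset_closure.trans hNW
    rw [mem_closure_iff_frequently, not_frequently]
    filter_upwards [h.eventually_mem (hNW' hr.1.1) h.mem hr.1.2.1.symm,
      h.eventually_mem (hNW' ht.1.1) h.mem ht.1.2.1.symm, isOpen_ne.mem_nhds ht.1.2.1.symm]
      with y h1 h2 h3 h4
    refine h4.2 ⟨⟨h4.1.1.1, ?_⟩, h3, h4.1.2.2⟩
    rw [h2, ht.2, ← hr.2, ← h1]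
    exact h4.1.1.2
  eq_empty r _ t _ Y hY := h.eq_empty Y
    (hY.trans (union_subset (fun p hp => hNW (subset_closure hp.1.1))
      fun p hp => hNW (subset_closure hp.1.1)))

theorem eventually_smallMoves (h : IsMovingFamily L Mb z Q W) (hN : IsOpen N)
    (hf : (frontier N).Finite) (hz : z ∈ N) (hNW : closure N ⊆ W) :
    ∀ᶠ r in 𝓝[≠] z, r ∈ smallMoves z Q N := by
  rw [eventually_nhdsWithin_iff]
  have : ∀ᶠ r in 𝓝 z, ∀ q ∈ frontier N, (q ∈ Q r ↔ q ∈ Q z) := by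
    rw [eventually_all_finite hf]
    refine fun q hq => h.eventually_iff q (hNW hq.1) ?_
    rintro rfl
    exact hq.2 (by rwa [hN.interior_eq])
  filter_upwards [this, hN.mem_nhds hz] with r h1 h2 h3
  exact ⟨h2, h3, h1⟩

/-- The moved set avoids the boundary of `N₁`, and its own boundary `{z, r}` lies in `N₁`; so the
part outside `closure N₁` has empty boundary and vanishes. Hence small moves sweep out small sets.
-/
theorem movedSet_subset [T2Space Mt] (h : IsMovingFamily L Mb z Q W)
    (hM : IsTTT (Mt := Mt) (Mb := Mb) φ) (hN : IsOpen N)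
    (hNd : DefinableSet L Mb N) (hz : z ∈ N) (hNW : closure N ⊆ W) (hN₁ : IsOpen N₁)
    (hNd₁ : DefinableSet L Mb N₁) (hz₁ : z ∈ N₁)
    (hr : r ∈ smallMoves z Q N) (hr₁ : r ∈ smallMoves z Q N₁) : movedSet z Q N r ⊆ N₁ := by
  have ho := h.isOpen_movedSet hN (subset_closure.trans hNW) hr.1
  have ho' := ho.sdiff (isClosed_closure (s := N₁))
  have hfr : ∀ y ∈ movedSet z Q N r, y ∉ frontier N₁ := fun y hy hy' => hy.1.2 (hr₁.2.2 y hy')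
  have hempty := h.eq_empty (movedSet z Q N r \ closure N₁)
    (fun p hp => hNW (subset_closure hp.1.1.1)) ho'
    ((h.definableSet_movedSet hNd r).diff (hM.definableSet_closure hNd₁)) fun y hy => by
      exfalso
      rw [ho'.frontier_eq] at hy
      have hyN₁ : y ∉ N₁ := fun hy' => by
        obtain ⟨q, hq, hq'⟩ := mem_closure_iff.1 hy.1 _ hN₁ hy'
        exact hq'.2 (subset_closure hq)
      have hyA : y ∈ movedSet z Q N r := by
        by_contra hyA
        have : y ∈ frontier (movedSet z Q N r) := by
          rw [ho.frontier_eq]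
          exact ⟨closure_mono sdiff_subset hy.1, hyA⟩
        rcases h.frontier_movedSet_subset hN hNW hr this with rfl | rfl
        · exact hyN₁ hz₁
        · exact hyN₁ hr₁.1
      refine hfr y hyA ⟨?_, by rwa [hN₁.interior_eq]⟩
      by_contra hyc
      exact hy.2 ⟨hyA, hyc⟩
  intro y hy
  by_contra hyN₁
  exact hfr y hy ⟨sdiff_eq_empty.1 hempty hy, by rwa [hN₁.interior_eq]⟩

theorem eventually_movedSet_iff [T2Space Mt] (h : IsMovingFamily L Mb z Q W) (hN : IsOpen N)
    (hz : z ∈ N) (hNW : closure N ⊆ W) (hr : r ∈ smallMoves z Q N) :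
    ∀ᶠ y in 𝓝[≠] z, (y ∈ movedSet z Q N r ↔ ¬ (y ∈ Q z ↔ z ∈ Q r)) := by
  rw [eventually_nhdsWithin_iff]
  filter_upwards [h.eventually_mem (hNW (subset_closure hr.1)) h.mem hr.2.1.symm,
    isOpen_ne.mem_nhds hr.2.1.symm, hN.mem_nhds hz] with y h1 h2 h3 h4
  have : y ∈ movedSet z Q N r ↔ (y ∈ N ∧ ¬ (y ∈ Q r ↔ y ∈ Q z)) ∧ y ≠ r ∧ y ≠ z := Iff.rfl
  have h4' : y ≠ z := h4
  have h2' : y ≠ r := h2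
  rw [this, h1]
  tauto

/-- Suppose the two memberships agree, with common value `p`, for points `s` and a much closer `s'`.
By `IsHalfChart.total` one lies in the moved set of the other. But the moved set of `s'` is too
small to contain `s`, and near `z` the moved set of `s` consists of points `y` for which `y ∈ Q z`
has the value opposite to `p`, excluding `s'`. -/
theorem eventually_side [T2Space Mt] (h : IsMovingFamily L Mb z Q W)
    (hM : IsTTT (Mt := Mt) (Mb := Mb) φ) (hdim : IsOneDimensional L Mt Mb) (hN : IsOpen N)
    (hNd : DefinableSet L Mb N) (hz : z ∈ N) (hNW : closure N ⊆ W) :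
    ∀ᶠ r in 𝓝[≠] z, (¬ (r ∈ Q z ↔ z ∈ Q r)) := by
  have hgood := h.eventually_smallMoves hN (hM.finite_frontier hdim hNd) hz hNW
  by_contra hcon
  have hfreq : ∃ᶠ r in 𝓝[≠] z, (r ∈ Q z ↔ z ∈ Q r) := by
    simpa only [not_eventually, not_not] using hcon
  have key : ∀ p : Prop, ¬ ∃ᶠ r in 𝓝[≠] z, (r ∈ Q z ↔ p) ∧ (z ∈ Q r ↔ p) := by
    intro p hp
    obtain ⟨s, ⟨hs1, hs2⟩, hs⟩ := (hp.and_eventually hgood).exists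
    obtain ⟨N₁, hN₁, hz₁, hN₁N⟩ := hM.exists_isBasisSet_closure_subset hdim
      (hN.sdiff isClosed_singleton) (⟨hz, hs.2.1.symm⟩ : z ∈ N \ {s})
    have hNo₁ := hM.isOpen_of_isBasisSet hN₁
    have hNd₁ := IsBasisSet.definableSet hN₁
    obtain ⟨s', ⟨hs1', hs2'⟩, hs', hs₁', hs₂'⟩ := (hp.and_eventually (hgood.and
      ((h.eventually_smallMoves hNo₁ (hM.finite_frontier hdim hNd₁) hz₁
        (hN₁N.trans (sdiff_subset.trans (subset_closure.trans hNW)))).and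
        (h.eventually_movedSet_iff hN hz hNW hs)))).exists
    have hsub := h.movedSet_subset hM hN hNd hz hNW hNo₁ hNd₁ hz₁ hs' hs₁'
    have hsN₁ : s ∉ N₁ := fun h' => (hN₁N (subset_closure h')).2 rfl
    rcases (h.isHalfChart hN hNd hz hNW p).total (r := s) (t := s') ⟨hs, hs2⟩ ⟨hs', hs2'⟩
      (by rintro rfl; exact hsN₁ hs₁'.1) with h1 | h1
    · exact hsN₁ (hsub h1)
    · rw [hs₂', hs1', hs2] at h1
      exact h1 Iff.rfl
  rcases frequently_or_distrib.1 (hfreq.mono fun r hr => show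
    ((r ∈ Q z ↔ True) ∧ (z ∈ Q r ↔ True)) ∨ ((r ∈ Q z ↔ False) ∧ (z ∈ Q r ↔ False)) by tauto)
    with h1 | h1
  · exact key _ h1
  · exact key _ h1

theorem exists_side [T2Space Mt] (h : IsMovingFamily L Mb z Q W)
    (hM : IsTTT (Mt := Mt) (Mb := Mb) φ) (hdim : IsOneDimensional L Mt Mb) (hN : IsOpen N)
    (hNd : DefinableSet L Mb N) (hz : z ∈ N) (hNW : closure N ⊆ W) {p : Prop}
    (hp : ∃ᶠ r in 𝓝[≠] z, ¬ (r ∈ Q z ↔ p)) :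
    ∃ t ∈ {r ∈ smallMoves z Q N | z ∈ Q r ↔ p},
      movedSet z Q N t ⊆ {r ∈ smallMoves z Q N | z ∈ Q r ↔ p} ∧
      ∀ y ∈ movedSet z Q N t, ¬ (y ∈ Q z ↔ p) := by
  have hNW' := subset_closure.trans hNW
  have hgood := h.eventually_smallMoves hN (hM.finite_frontier hdim hNd) hz hNW
  have hside := h.eventually_side hM hdim hN hNd hz hNW
  obtain ⟨O, hO, hzO, hON⟩ := mem_nhdsWithin.1 (hgood.and hside)
  obtain ⟨N₁, hN₁, hz₁, hN₁O⟩ := hM.exists_isBasisSet_closure_subset hdim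
    (hO.inter hN) (⟨hzO, hz⟩ : z ∈ O ∩ N)
  have hNo₁ := hM.isOpen_of_isBasisSet hN₁
  have hNd₁ := IsBasisSet.definableSet hN₁
  obtain ⟨t, htp, ⟨ht, hts⟩, ht₁⟩ := (hp.and_eventually ((hgood.and hside).and
    (h.eventually_smallMoves hNo₁ (hM.finite_frontier hdim hNd₁) hz₁
        (hN₁O.trans (inter_subset_right.trans hNW'))))).exists
  have htR : t ∈ {r ∈ smallMoves z Q N | z ∈ Q r ↔ p} := ⟨ht, by tauto⟩
  have hsub := h.movedSet_subset hM hN hNd hz hNW hNo₁ hNd₁ hz₁ ht ht₁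
  have ho := h.isOpen_movedSet hN hNW' ht.1
  -- The points of the moved set on the wrong side of `Q z` form an open set whose boundary is at
  -- most `z`: `Q z` is locally constant elsewhere, and `t` is on the right side.
  have hmem : ∀ y ∈ movedSet z Q N t, ¬ (y ∈ Q z ↔ p) := by
    have hYo : IsOpen {y ∈ movedSet z Q N t | y ∈ Q z ↔ p} := by
      rw [isOpen_iff_mem_nhds]
      rintro y ⟨hy, hyp⟩
      filter_upwards [ho.mem_nhds hy, h.eventually_mem h.mem (hNW' hy.1.1) hy.2.2] with q h1 h2
      exact ⟨h1, h2.trans hyp⟩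
    have hYd : DefinableSet L Mb {y ∈ movedSet z Q N t | y ∈ Q z ↔ p} :=
      (h.definableSet_movedSet hNd t).inter
        (definableSet_iff.2 ((definableSet_iff.1 (h.definableSet z)).iff (.const p)))
    have hY := h.eq_empty _ (fun y hy => hNW' hy.1.1.1) hYo hYd fun y hy => by
      rw [hYo.frontier_eq] at hy
      have hyc := mem_closure_iff_frequently.1 hy.1
      by_cases hyA : y ∈ movedSet z Q N t
      · obtain ⟨q, hq, hq'⟩ := (hyc.and_eventually
          (h.eventually_mem h.mem (hNW' hyA.1.1) hyA.2.2)).exists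
        exact (hy.2 ⟨hyA, hq'.symm.trans hq.2⟩).elim
      · have hyf : y ∈ frontier (movedSet z Q N t) := by
          rw [ho.frontier_eq]
          exact ⟨closure_mono (sep_subset _ _) hy.1, hyA⟩
        refine (h.frontier_movedSet_subset hN hNW ht hyf).resolve_right fun hyt => ?_
        obtain rfl : y = t := hyt
        obtain ⟨q, hq, hq'⟩ := (hyc.and_eventually
          (h.eventually_mem h.mem (hNW' ht.1) ht.2.1)).exists
        exact htp (hq'.symm.trans hq.2)
    intro y hy hyp
    exact (hY ▸ (⟨hy, hyp⟩ : y ∈ {y ∈ movedSet z Q N t | y ∈ Q z ↔ p}) : y ∈ (∅ : Set Mt))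
  refine ⟨t, htR, fun y hy => ?_, hmem⟩
  have h1 := hON ⟨(hN₁O (subset_closure (hsub hy))).1, hy.2.2⟩
  have h2 := hmem y hy
  have h3 := h1.2
  exact ⟨h1.1, by tauto⟩

theorem exists_isOrderChart (h : IsMovingFamily L Mb z Q W)
    (hM : IsTTT (Mt := Mt) (Mb := Mb) φ) (hdim : IsOneDimensional L Mt Mb) :
    ∃ (D : Set Mt) (lt : Mt → Mt → Prop), IsOrderChart L Mb D lt ∧ z ∈ D ∧
      (∃ d ∈ D, lt d z) ∧ ∃ d ∈ D, lt z d := by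
  have := hM.hausdorff
  obtain ⟨N, hN, hz, hNW⟩ := hM.exists_isBasisSet_closure_subset hdim h.isOpen h.mem
  have hNo := hM.isOpen_of_isBasisSet hN
  have hNd := IsBasisSet.definableSet hN
  obtain ⟨t, ht, htR, htG⟩ := h.exists_side hM hdim hNo hNd hz hNW (p := False)
    ((mem_closure_diff_singleton_iff_frequently.1 h.splits.1).mono fun r hr => by tauto)
  obtain ⟨t', ht', htR', htG'⟩ := h.exists_side hM hdim hNo hNd hz hNW (p := True)
    ((mem_closure_diff_singleton_iff_frequently.1 h.splits.2).mono fun r hr => by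
      have : r ∉ Q z := hr
      tauto)
  refine (h.isHalfChart hNo hNd hz hNW False).exists_isOrderChart
    (h.isHalfChart hNo hNd hz hNW True) hM ht htR ht' htR'
    (disjoint_left.2 fun y hy hy' => ?_) ?_
  · have h1 := htG y hy
    have h2 := htG' y hy'
    tauto
  · filter_upwards [h.eventually_movedSet_iff hNo hz hNW ht.1,
      h.eventually_movedSet_iff hNo hz hNW ht'.1] with y h1 h2
    rw [h1, h2, ht.2, ht'.2]
    tauto

end IsMovingFamily

/-- With `F x y = y - x` in mind, `F r ⁻¹' (F z '' C)` is the translate of `C` taking `z` to `r`. -/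
theorem HasDifferenceFun.exists_isOrderChart (hF : HasDifferenceFun L Mt Mb)
    (hM : IsTTT (Mt := Mt) (Mb := Mb) φ) (hdim : IsOneDimensional L Mt Mb) {C : Set Mt} {z : Mt}
    (hC : DefinableSet L Mb C) (hz : Splits C z) :
    ∃ (D : Set Mt) (lt : Mt → Mt → Prop), IsOrderChart L Mb D lt ∧ z ∈ D ∧
      (∃ d ∈ D, lt d z) ∧ ∃ d ∈ D, lt z d := by
  have := hM.hausdorff
  obtain ⟨F, a, hFd, hFc, hFa⟩ := hF
  have hFm : DefMap L (Mt ⊕ Mb) fun p : Mt × Mt => F p.1 p.2 := by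
    refine defMap_iff.2 ((definableRel_iff.1 hFd).comp
      (f := fun q : (Mt × Mt) × Mt => ![q.1.1, q.1.2, q.2]) (DefMap.pi fun i => ?_))
    fin_cases i
    · exact DefMap.comp' (g := Prod.fst) (by fun_prop) (by fun_prop)
    · exact DefMap.comp' (g := Prod.snd) (by fun_prop) (by fun_prop)
    · exact DefMap.snd'
  have hId : DefinableSet L Mb (F z '' C) := by
    rw [definableSet_iff]
    refine DefPred.exists (P := fun y x => x ∈ C ∧ F z x = y)
      ((definableSet_iff.1 hC).snd.and (DefPred.eq ?_ (by fun_prop)))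
    exact hFm.comp' (f := fun p : Mt × Mt => (z, p.2)) (by fun_prop)
  have hQz : F z ⁻¹' (F z '' C) = C := preimage_image_eq C (hFa z).2
  have hcont : ∀ x, Continuous (F x) := fun x => hFc.comp (by fun_prop : Continuous fun y => (x, y))
  have hcont' : ∀ y, Continuous fun x => F x y :=
    fun y => hFc.comp (by fun_prop : Continuous fun x => (x, y))
  obtain ⟨U, hU, hzU, hUe⟩ := hM.exists_nhds_frontier_subset hz.not_isOpen_singleton
  have hP : IsOpen (Function.uncurry F ⁻¹' (frontier (F z '' C) \ {a})ᶜ) :=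
    ((hM.finite_frontier hdim hId).subset sdiff_subset).isClosed.isOpen_compl.preimage hFc
  obtain ⟨V₁, V₂, hV₁, hz₁, hV₂, hz₂, hV⟩ := mem_nhds_prod_iff'.1 (hP.mem_nhds
    (show (z, z) ∈ _ from fun h => h.2 (hFa z).1))
  -- The boundary of `F z '' C` is finite, so near `(z, z)` the only value of `F` it can contain is
  -- `a`; and `F r y = a = F r r` forces `y = r`.
  have hfr : ∀ r ∈ U ∩ (V₁ ∩ V₂), ∀ y ∈ U ∩ (V₁ ∩ V₂), F r y ∈ frontier (F z '' C) → y = r := by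
    intro r hr y hy hf
    have h1 : F r y = a := by
      by_contra hne
      exact hV (⟨hr.2.1, hy.2.2⟩ : (r, y) ∈ V₁ ×ˢ V₂) ⟨hf, hne⟩
    exact (hFa r).2 (h1.trans (hFa r).1.symm)
  refine IsMovingFamily.exists_isOrderChart (Q := fun r => F r ⁻¹' (F z '' C))
    (W := U ∩ (V₁ ∩ V₂)) ⟨?_, ?_, ?_, ?_, ?_, ?_, ?_⟩ hM hdim
  · exact (definableSet_iff.1 hId).comp hFm
  · rwa [hQz]
  · exact hU.inter (hV₁.inter hV₂)
  · exact ⟨hzU, hz₁, hz₂⟩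
  · exact fun r hr y hy hf => hfr r hr y hy ((hcont r).frontier_preimage_subset _ hf)
  · intro q hq hqz
    exact (hcont' q).continuousAt.eventually (notMem_frontier_iff_eventually.1
      fun hf => hqz (hfr z ⟨hzU, hz₁, hz₂⟩ q hq hf))
  · exact fun Y hY => hUe Y (hY.trans inter_subset_left)

end TTT

namespace TTT

open Filter Topology

variable {L : FirstOrder.Language.{u, v}} {Mt : Type w} {Mb : Type w'} [L.Structure (Mt ⊕ Mb)]
variable [Fact (IsTwoSorted L Mt Mb)] [TopologicalSpace Mt] {k : ℕ} {φ : L.Formula (Fin 1 ⊕ Fin k)}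

/-! ### Basis sets with two boundary points -/

theorem encard_eq_two_unique {α : Type*} {s : Set α} (hs : s.encard = 2) {a b c : α} (ha : a ∈ s)
    (hb : b ∈ s) (hc : c ∈ s) (hac : a ≠ c) (hbc : b ≠ c) : a = b := by
  obtain ⟨p, q, -, rfl⟩ := encard_eq_two.1 hs
  simp only [mem_insert_iff, mem_singleton_iff] at ha hb hc
  grind

/-- For small `V` containing `x`, the nonempty open set `V ∩ G` needs a boundary point besides `x`.
As `U` stays away from the other boundary points of `G`, it is a boundary point of `V` inside `G`.
-/
theorem IsTTT.exists_nhds_frontier_inter_nonempty (hM : IsTTT (Mt := Mt) (Mb := Mb) φ)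
    (hdim : IsOneDimensional L Mt Mb) {x : Mt} {G : Set Mt} (hG : IsOpen G)
    (hGd : DefinableSet L Mb G) (hx : x ∈ closure G) (hxG : x ∉ G) :
    ∃ U : Set Mt, IsOpen U ∧ x ∈ U ∧ ∀ V ⊆ U, IsOpen V → DefinableSet L Mb V → x ∈ V →
      (frontier V ∩ G).Nonempty := by
  have := hM.hausdorff
  have hiso : ¬ IsOpen ({x} : Set Mt) := fun ho => by
    obtain ⟨y, hy, hy'⟩ := mem_closure_iff.1 hx _ ho rfl
    obtain rfl : y = x := hy
    exact hxG hy'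
  obtain ⟨U₀, hU₀, hxU₀, hE⟩ := hM.exists_nhds_frontier_subset hiso
  obtain ⟨U, hU, hxU, hUU⟩ := hM.exists_isBasisSet_closure_subset hdim
    (hU₀.sdiff ((hM.finite_frontier hdim hGd).subset sdiff_subset).isClosed)
    (⟨hxU₀, fun h => h.2 rfl⟩ : x ∈ U₀ \ (frontier G \ {x}))
  refine ⟨U, hM.isOpen_of_isBasisSet hU, hxU, fun V hVU hV hVd hxV => ?_⟩
  by_contra hne
  obtain ⟨y, hy⟩ := mem_closure_iff.1 hx V hV hxV
  have ho := hV.inter hG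
  refine (hE (V ∩ G) (fun y hy => (hUU (subset_closure (hVU hy.1))).1) ho (hVd.inter hGd)
    fun z hz => ?_ : V ∩ G = ∅).subset hy
  rw [ho.frontier_eq] at hz
  by_contra hzx
  have hz1 : z ∈ closure V := closure_mono inter_subset_left hz.1
  have hz2 : z ∈ closure G := closure_mono inter_subset_right hz.1
  have hzG : z ∈ G := by
    by_contra hzG
    exact (hUU (closure_mono hVU hz1)).2 ⟨by rw [hG.frontier_eq]; exact ⟨hz2, hzG⟩, hzx⟩
  exact hne ⟨z, by rw [hV.frontier_eq]; exact ⟨hz1, fun h => hz.2 ⟨h, hzG⟩⟩, hzG⟩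

theorem mem_closure_of_disjoint {α : Type*} [TopologicalSpace α] {G H : Set α} {x : α}
    (hG : IsOpen G) (hd : Disjoint G H) (hx : x ∈ closure H) : x ∉ G := fun hxG => by
  obtain ⟨y, hy, hy'⟩ := mem_closure_iff.1 hx G hG hxG
  exact disjoint_left.1 hd hy hy'

/-- At most two disjoint definable open sets accumulate at a given point. -/
theorem HasTwoPointBoundaries.not_three (h2 : HasTwoPointBoundaries (Mt := Mt) (Mb := Mb) φ)
    (hM : IsTTT (Mt := Mt) (Mb := Mb) φ)
    (hdim : IsOneDimensional L Mt Mb) {x : Mt} {G₁ G₂ G₃ : Set Mt} (h₁ : IsOpen G₁)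
    (h₂ : IsOpen G₂) (h₃ : IsOpen G₃) (d₁ : DefinableSet L Mb G₁) (d₂ : DefinableSet L Mb G₂)
    (d₃ : DefinableSet L Mb G₃) (h₁₂ : Disjoint G₁ G₂) (h₁₃ : Disjoint G₁ G₃)
    (h₂₃ : Disjoint G₂ G₃) (hx₁ : x ∈ closure G₁) (hx₂ : x ∈ closure G₂) (hx₃ : x ∈ closure G₃) :
    False := by
  obtain ⟨U₁, hU₁, hxU₁, hV₁⟩ := hM.exists_nhds_frontier_inter_nonempty hdim h₁ d₁ hx₁
    (mem_closure_of_disjoint h₁ h₁₂ hx₂)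
  obtain ⟨U₂, hU₂, hxU₂, hV₂⟩ := hM.exists_nhds_frontier_inter_nonempty hdim h₂ d₂ hx₂
    (mem_closure_of_disjoint h₂ h₂₃ hx₃)
  obtain ⟨U₃, hU₃, hxU₃, hV₃⟩ := hM.exists_nhds_frontier_inter_nonempty hdim h₃ d₃ hx₃
    (mem_closure_of_disjoint h₃ h₁₃.symm hx₁)
  -- A small basis neighbourhood of `x` would have a boundary point in each of the three sets.
  obtain ⟨V, hV, hxV, hVU⟩ := hM.isBasis.exists_subset_of_mem_open
    (⟨hxU₁, hxU₂, hxU₃⟩ : x ∈ U₁ ∩ (U₂ ∩ U₃)) (hU₁.inter (hU₂.inter hU₃))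
  have hVo := hM.isOpen_of_isBasisSet hV
  have hVd := IsBasisSet.definableSet hV
  obtain ⟨p, hp, hp'⟩ := hV₁ V (fun y hy => (hVU hy).1) hVo hVd hxV
  obtain ⟨q, hq, hq'⟩ := hV₂ V (fun y hy => (hVU hy).2.1) hVo hVd hxV
  obtain ⟨r, hr, hr'⟩ := hV₃ V (fun y hy => (hVU hy).2.2) hVo hVd hxV
  have hpq := encard_eq_two_unique (h2 V hV ⟨x, hxV⟩) hp hq hr
    (fun e => disjoint_left.1 h₁₃ hp' (e ▸ hr')) (fun e => disjoint_left.1 h₂₃ hq' (e ▸ hr'))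
  exact disjoint_left.1 h₁₂ hp' (hpq ▸ hq')

theorem IsTTT.mem_closure_interior (hM : IsTTT (Mt := Mt) (Mb := Mb) φ)
    (hdim : IsOneDimensional L Mt Mb) {x : Mt} {X : Set Mt} (hX : DefinableSet L Mb X)
    (hx : x ∈ closure (X \ {x})) : x ∈ closure (interior X) := by
  have := hM.hausdorff
  have h1 : X \ {x} ⊆ interior X ∪ (frontier X \ {x}) := fun y hy => by
    by_cases h : y ∈ interior X
    · exact .inl h
    · exact .inr ⟨⟨subset_closure hy.1, h⟩, hy.2⟩
  have h2 := closure_mono h1 hx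
  rw [closure_union, ((hM.finite_frontier hdim hX).subset sdiff_subset).isClosed.closure_eq] at h2
  exact h2.resolve_right fun h => h.2 rfl

/-- A splitting of `x` into two sides `G` and `H`, with a neighbourhood `U` of `x` such that every
basis neighbourhood of `x` in `U` has one boundary point on each side. -/
structure IsSidedNhd (φ : L.Formula (Fin 1 ⊕ Fin k)) (x : Mt) (G H U : Set Mt) : Prop where
  isOpen_left : IsOpen G
  isOpen_right : IsOpen H
  definable_left : DefinableSet L Mb G
  definable_right : DefinableSet L Mb H
  disjoint : Disjoint G H
  mem_closure_left : x ∈ closure G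
  mem_closure_right : x ∈ closure H
  isOpen : IsOpen U
  definable : DefinableSet L Mb U
  mem : x ∈ U
  eq_of_mem_frontier : ∀ y ∈ closure U, y ∈ frontier G → y = x
  eq_empty : ∀ Y ⊆ closure U, IsOpen Y → DefinableSet L Mb Y → frontier Y ⊆ {x} → Y = ∅
  frontier_left : ∀ V : Set Mt, IsBasisSet (Mb := Mb) φ V → x ∈ V → V ⊆ U →
    (frontier V ∩ G).Nonempty
  frontier_right : ∀ V : Set Mt, IsBasisSet (Mb := Mb) φ V → x ∈ V → V ⊆ U →
    (frontier V ∩ H).Nonempty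

namespace IsSidedNhd

variable {x r t : Mt} {G H U V V' : Set Mt}

/-- The boundary points in `G` of basis neighbourhoods of `x` in `U`. -/
def endpoints (Mb : Type w') [L.Structure (Mt ⊕ Mb)] (φ : L.Formula (Fin 1 ⊕ Fin k)) (x : Mt)
    (G U : Set Mt) : Set Mt :=
  {r | r ∈ G ∧ ∃ b : Fin k → Mb, (x ∈ basisSet φ b ∧ ∀ y, y ∈ basisSet φ b → y ∈ U) ∧
    r ∈ frontier (basisSet φ b)}

/-- The part in `G` of the basis neighbourhoods of `x` in `U` that have `r` as a boundary point. -/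
def segment (Mb : Type w') [L.Structure (Mt ⊕ Mb)] (φ : L.Formula (Fin 1 ⊕ Fin k)) (x : Mt)
    (G U : Set Mt) (r : Mt) : Set Mt :=
  {z | z ∈ G ∧ ∃ b : Fin k → Mb, ((x ∈ basisSet φ b ∧ ∀ y, y ∈ basisSet φ b → y ∈ U) ∧
    r ∈ frontier (basisSet φ b)) ∧ z ∈ basisSet φ b}

theorem notMem_left (h : IsSidedNhd (Mb := Mb) φ x G H U) : x ∉ G :=
  mem_closure_of_disjoint h.isOpen_left h.disjoint h.mem_closure_right

/-- One of the two boundary points of `V` lies in `H`, so `r` is the only one in `G`; the other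
boundary points of `V ∩ G` come from `G` and can only be `x`. -/
theorem frontier_inter_left (h : IsSidedNhd (Mb := Mb) φ x G H U)
    (h2 : HasTwoPointBoundaries (Mt := Mt) (Mb := Mb) φ) (hM : IsTTT (Mt := Mt) (Mb := Mb) φ)
    (hV : IsBasisSet (Mb := Mb) φ V) (hx : x ∈ V) (hVU : V ⊆ U) (hr : r ∈ frontier V)
    (hrG : r ∈ G) : frontier (V ∩ G) = {x, r} := by
  have hVo := hM.isOpen_of_isBasisSet hV
  have ho := hVo.inter h.isOpen_left
  rw [ho.frontier_eq]
  rw [hVo.frontier_eq] at hr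
  refine Subset.antisymm (fun y hy => ?_) (insert_subset ?_ (singleton_subset_iff.2 ?_))
  · have hy1 : y ∈ closure V := closure_mono inter_subset_left hy.1
    have hy2 : y ∈ closure G := closure_mono inter_subset_right hy.1
    by_cases hyG : y ∈ G
    · obtain ⟨s, hs, hsH⟩ := h.frontier_right V hV hx hVU
      refine .inr (encard_eq_two_unique (h2 V hV ⟨x, hx⟩) (c := s) ?_ ?_ hs ?_ ?_)
      · rw [hVo.frontier_eq]
        exact ⟨hy1, fun h' => hy.2 ⟨h', hyG⟩⟩
      · rwa [hVo.frontier_eq]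
      · rintro rfl
        exact disjoint_left.1 h.disjoint hyG hsH
      · rintro rfl
        exact disjoint_left.1 h.disjoint hrG hsH
    · refine .inl (h.eq_of_mem_frontier y (closure_mono hVU hy1) ?_)
      rw [h.isOpen_left.frontier_eq]
      exact ⟨hy2, hyG⟩
  · exact ⟨hVo.inter_closure ⟨hx, h.mem_closure_left⟩, fun h' => h.notMem_left h'.2⟩
  · exact ⟨h.isOpen_left.closure_inter ⟨hr.1, hrG⟩, fun h' => hr.2 h'.1⟩

/-- If the inclusion failed, then `A \ closure A'`, `A ∩ A'` and the complement of `closure (A ∪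
A')` would be three disjoint open sets accumulating at `r`: were one not to do so, rigidity at `x`
would be violated. By symmetry the part in `G` is determined by `r`. -/
theorem inter_subset_inter (h : IsSidedNhd (Mb := Mb) φ x G H U)
    (h2 : HasTwoPointBoundaries (Mt := Mt) (Mb := Mb) φ) (hM : IsTTT (Mt := Mt) (Mb := Mb) φ)
    (hdim : IsOneDimensional L Mt Mb)
    (hV : IsBasisSet (Mb := Mb) φ V) (hx : x ∈ V) (hVU : V ⊆ U) (hr : r ∈ frontier V)
    (hV' : IsBasisSet (Mb := Mb) φ V') (hx' : x ∈ V') (hVU' : V' ⊆ U) (hr' : r ∈ frontier V')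
    (hrG : r ∈ G) : V ∩ G ⊆ V' ∩ G := by
  have f1 := h.frontier_inter_left h2 hM hV hx hVU hr hrG
  have f2 := h.frontier_inter_left h2 hM hV' hx' hVU' hr' hrG
  have hVo := hM.isOpen_of_isBasisSet hV
  have hVo' := hM.isOpen_of_isBasisSet hV'
  have o1 := hVo.inter h.isOpen_left
  have o2 := hVo'.inter h.isOpen_left
  have d1 := (IsBasisSet.definableSet hV).inter h.definable_left
  have d2 := (IsBasisSet.definableSet hV').inter h.definable_left
  have s1 : V ∩ G ⊆ closure U := inter_subset_left.trans (hVU.trans subset_closure)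
  have s2 : V' ∩ G ⊆ closure U := inter_subset_left.trans (hVU'.trans subset_closure)
  have hxr : r ≠ x := fun e => h.notMem_left (e ▸ hrG)
  have hx1 : x ∉ V ∩ G := fun h' => h.notMem_left h'.2
  have hr1 : r ∉ V ∩ G := fun h' => (hVo.frontier_eq ▸ hr).2 h'.1
  set A := V ∩ G with hA
  set A' := V' ∩ G with hA'
  have cl : ∀ {X : Set Mt} (_ : frontier X = {x, r}) {y : Mt}, y ∈ closure X ↔
      y ∈ X ∨ y = x ∨ y = r := fun hX y => by
    rw [closure_eq_self_union_frontier, hX]; rfl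
  by_cases hne : A \ closure A' = ∅
  · intro y hy
    have := (cl f2).1 (sdiff_eq_empty.1 hne hy)
    grind
  exfalso
  have hxA' : x ∈ closure A' := (cl f2).2 (.inr (.inl rfl))
  have o3 : IsOpen (A \ closure A') := o1.sdiff isClosed_closure
  have d3 := d1.diff (hM.definableSet_closure d2)
  refine h2.not_three hM hdim (x := r) o3 (o1.inter o2)
    (isClosed_closure (s := A ∪ A')).isOpen_compl d3 (d1.inter d2)
    (hM.definableSet_closure (d1.union d2)).compl ?_ ?_ ?_ ?_ ?_ ?_
  · exact disjoint_left.2 fun y hy hy' => hy.2 (subset_closure hy'.2)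
  · exact disjoint_left.2 fun y hy hy' => hy' (subset_closure (.inl hy.1))
  · exact disjoint_left.2 fun y hy hy' => hy' (subset_closure (.inl hy.1))
  · by_contra hcon
    refine hne (h.eq_empty _ (sdiff_subset.trans s1) o3 d3 fun y hy => ?_)
    rw [o3.frontier_eq] at hy
    have hy1 := (cl f1).1 (closure_mono sdiff_subset hy.1)
    have hy2 : y ∉ A' := fun hyA => by
      obtain ⟨p, hp, hp'⟩ := mem_closure_iff.1 hy.1 _ o2 hyA
      exact hp'.2 (subset_closure hp)
    have hy3 := @cl A' f2 y
    have hy4 := hy.1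
    have hy5 := hy.2
    rw [Set.mem_sdiff] at hy5
    rw [mem_singleton_iff]
    grind
  · by_contra hcon
    have hx2 : x ∈ closure (A ∩ A') := by
      have h1 : x ∈ closure (V' ∩ A) := hVo'.inter_closure ⟨hx', (cl f1).2 (.inr (.inl rfl))⟩
      exact closure_mono (fun y hy => (⟨hy.2, hy.1, hy.2.2⟩ : y ∈ A ∩ A')) h1
    have he := h.eq_empty _ (inter_subset_left.trans s1) (o1.inter o2) (d1.inter d2) fun y hy => by
      rw [(o1.inter o2).frontier_eq] at hy
      have hy1 := (cl f1).1 (closure_mono inter_subset_left hy.1)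
      have hy2 := (cl f2).1 (closure_mono inter_subset_right hy.1)
      have hy4 := hy.1
      have hy5 := hy.2
      rw [mem_inter_iff] at hy5
      rw [mem_singleton_iff]
      grind
    rw [he, closure_empty] at hx2
    exact hx2
  · by_contra hcon
    have hev : ∀ᶠ y in 𝓝 r, y ∈ A ∪ A' ∪ {r} := by
      rw [mem_closure_iff_frequently, not_frequently] at hcon
      have := hM.hausdorff
      filter_upwards [hcon, isOpen_ne.mem_nhds hxr] with y hy hyx
      rw [mem_compl_iff, not_not, closure_union] at hy
      have hy1 := @cl A f1 y
      have hy2 := @cl A' f2 y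
      simp only [mem_union, mem_singleton_iff] at hy ⊢
      have hyx' : y ≠ x := hyx
      grind
    have o4 : IsOpen (A ∪ A' ∪ {r}) := by
      rw [isOpen_iff_mem_nhds]
      rintro y (hy | rfl)
      · exact mem_of_superset ((o1.union o2).mem_nhds hy) subset_union_left
      · exact hev
    have he := h.eq_empty _ (union_subset (union_subset s1 s2) (singleton_subset_iff.2
      (closure_mono hVU hr.1))) o4 ((d1.union d2).union (.singleton r)) fun y hy => by
        rw [o4.frontier_eq, closure_union, closure_union] at hy
        have := hM.hausdorff
        have hy1 := @cl A f1 y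
        have hy2 := @cl A' f2 y
        have hy3 := hy.1
        have hy4 := hy.2
        simp only [mem_union, mem_singleton_iff, closure_singleton] at hy3 hy4 ⊢
        grind
    exact (he ▸ (.inr rfl : r ∈ A ∪ A' ∪ {r}) : r ∈ (∅ : Set Mt))

theorem segment_eq (h : IsSidedNhd (Mb := Mb) φ x G H U)
    (h2 : HasTwoPointBoundaries (Mt := Mt) (Mb := Mb) φ) (hM : IsTTT (Mt := Mt) (Mb := Mb) φ)
    (hdim : IsOneDimensional L Mt Mb)
    (hV : IsBasisSet (Mb := Mb) φ V) (hx : x ∈ V) (hVU : V ⊆ U) (hr : r ∈ frontier V)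
    (hrG : r ∈ G) : segment Mb φ x G U r = V ∩ G := by
  refine Subset.antisymm ?_ ?_
  · rintro y ⟨hyG, b, ⟨⟨h1, h3⟩, h4⟩, h5⟩
    exact h.inter_subset_inter h2 hM hdim ⟨b, rfl⟩ h1 h3 h4 hV hx hVU hr hrG ⟨h5, hyG⟩
  · obtain ⟨b, rfl⟩ := hV
    exact fun y hy => ⟨hy.2, b, ⟨⟨hx, hVU⟩, hr⟩, hy.1⟩

theorem defPred_endpoints (hM : IsTTT (Mt := Mt) (Mb := Mb) φ) (hU : DefinableSet L Mb U) (x : Mt) :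
    DefPred L (Mt ⊕ Mb) fun p : Mt × (Fin k → Mb) =>
      (x ∈ basisSet φ p.2 ∧ ∀ y, y ∈ basisSet φ p.2 → y ∈ U) ∧ p.1 ∈ frontier (basisSet φ p.2) := by
  have hφ := defPred_basisSet (Mt := Mt) (Mb := Mb) φ
  refine (DefPred.and ?_ (DefPred.forall (DefPred.imp ?_ (definableSet_iff.1 hU).snd))).and ?_
  · exact hφ.comp (f := fun p : Mt × (Fin k → Mb) => (p.2, x)) (by fun_prop)
  · exact hφ.comp (f := fun q : (Mt × (Fin k → Mb)) × Mt => (q.1.2, q.2)) (by fun_prop)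
  · exact (hM.defPred_frontier (A := fun b : Fin k → Mb => basisSet φ b) hφ).comp
      (f := fun p : Mt × (Fin k → Mb) => (p.2, p.1)) (by fun_prop)

theorem exists_isHalfChart (h : IsSidedNhd (Mb := Mb) φ x G H U)
    (h2 : HasTwoPointBoundaries (Mt := Mt) (Mb := Mb) φ) (hM : IsTTT (Mt := Mt) (Mb := Mb) φ)
    (hdim : IsOneDimensional L Mt Mb) :
    ∃ (R : Set Mt) (A : Mt → Set Mt), IsHalfChart L Mb x R A ∧ ∃ t ∈ R, A t ⊆ R ∧ A t ⊆ G ∧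
      ∀ᶠ y in 𝓝 x, y ∈ G → y ∈ A t := by
  have hφ := defPred_basisSet (Mt := Mt) (Mb := Mb) φ
  have hend := defPred_endpoints hM h.definable x
  have hGd := definableSet_iff.1 h.definable_left
  have hRd : DefinableSet L Mb (endpoints Mb φ x G U) :=
    definableSet_iff.2 (hGd.and hend.exists)
  have hseg : ∀ r ∈ endpoints Mb φ x G U, ∃ V : Set Mt, IsBasisSet (Mb := Mb) φ V ∧ x ∈ V ∧
      V ⊆ U ∧ r ∈ frontier V ∧ segment Mb φ x G U r = V ∩ G := by
    rintro r ⟨hrG, b, ⟨h1, h3⟩, h4⟩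
    exact ⟨_, ⟨b, rfl⟩, h1, h3, h4, h.segment_eq h2 hM hdim ⟨b, rfl⟩ h1 h3 h4 hrG⟩
  have hxG := h.notMem_left
  refine ⟨endpoints Mb φ x G U, segment Mb φ x G U, ⟨?_, ?_, ?_, ?_, ?_, ?_⟩, ?_⟩
  · refine hGd.snd.and (DefPred.exists (DefPred.and ?_ ?_))
    · exact hend.comp (f := fun q : (Mt × Mt) × (Fin k → Mb) => (q.1.1, q.2)) (by fun_prop)
    · exact hφ.comp (f := fun q : (Mt × Mt) × (Fin k → Mb) => (q.2, q.1.2)) (by fun_prop)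
  · intro r hr
    obtain ⟨V, hV, -, -, -, e⟩ := hseg r hr
    rw [e]
    exact (hM.isOpen_of_isBasisSet hV).inter h.isOpen_left
  · intro r hr
    obtain ⟨V, hV, hx, hVU, hrV, e⟩ := hseg r hr
    rw [e]
    exact h.frontier_inter_left h2 hM hV hx hVU hrV hr.1
  · exact fun h' => hxG h'.1
  · intro r hr t ht
    obtain ⟨V, hV, hx, hVU, hrV, e⟩ := hseg r hr
    obtain ⟨V', hV', hx', hVU', hrV', e'⟩ := hseg t ht
    rw [e, e', mem_closure_iff_frequently, not_frequently]
    filter_upwards [(hM.isOpen_of_isBasisSet hV').mem_nhds hx'] with y hy hy'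
    exact hy'.2 ⟨hy, hy'.1.2⟩
  · intro r hr t ht Y hY
    obtain ⟨V, hV, hx, hVU, hrV, e⟩ := hseg r hr
    obtain ⟨V', hV', hx', hVU', hrV', e'⟩ := hseg t ht
    refine h.eq_empty Y (hY.trans (union_subset ?_ ?_))
    · rw [e]; exact inter_subset_left.trans (hVU.trans subset_closure)
    · rw [e']; exact inter_subset_left.trans (hVU'.trans subset_closure)
  · have hxR : x ∈ closure (endpoints Mb φ x G U) := by
      rw [mem_closure_iff]
      intro O hO hxO
      obtain ⟨V, hV, hxV, hVO⟩ := hM.exists_isBasisSet_closure_subset hdim (hO.inter h.isOpen)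
        (⟨hxO, h.mem⟩ : x ∈ O ∩ U)
      have hVU : V ⊆ U := fun y hy => (hVO (subset_closure hy)).2
      obtain ⟨r, hr, hrG⟩ := h.frontier_left V hV hxV hVU
      obtain ⟨b, rfl⟩ := hV
      exact ⟨r, (hVO hr.1).1, hrG, b, ⟨hxV, hVU⟩, hr⟩
    have hxi : x ∈ closure (interior (endpoints Mb φ x G U)) :=
      hM.mem_closure_interior hdim hRd (by
        rwa [sdiff_singleton_eq_self (fun h' => hxG h'.1)])
    -- Otherwise the interiors of the endpoint set and of its complement in `G` would accumulate at
    -- `x` together with `H`. So every point of `G` near `x` is an endpoint.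
    have hxn : x ∉ closure (G \ endpoints Mb φ x G U) := fun hcon => by
      have hd := h.definable_left.diff hRd
      have hci : x ∈ closure (interior (G \ endpoints Mb φ x G U)) :=
        hM.mem_closure_interior hdim hd (by
          rwa [sdiff_singleton_eq_self (fun h' => hxG h'.1)])
      refine h2.not_three hM hdim isOpen_interior isOpen_interior h.isOpen_right
        (hM.definableSet_interior hRd) (hM.definableSet_interior hd) h.definable_right ?_ ?_ ?_
        hxi hci h.mem_closure_right
      · exact disjoint_left.2 fun y hy hy' => (interior_subset hy').2 (interior_subset hy)
      · exact disjoint_left.2 fun y hy => disjoint_left.1 h.disjoint (interior_subset hy).1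
      · exact disjoint_left.2 fun y hy => disjoint_left.1 h.disjoint (interior_subset hy).1
    obtain ⟨V, hV, hxV, hVO⟩ := hM.isBasis.exists_subset_of_mem_open
      (⟨hxn, h.mem⟩ : x ∈ (closure (G \ endpoints Mb φ x G U))ᶜ ∩ U)
      (isClosed_closure.isOpen_compl.inter h.isOpen)
    have hVU : V ⊆ U := fun y hy => (hVO hy).2
    obtain ⟨t, ht, htG⟩ := h.frontier_left V hV hxV hVU
    have e := h.segment_eq h2 hM hdim hV hxV hVU ht htG
    have htR : t ∈ endpoints Mb φ x G U := by
      obtain ⟨b, rfl⟩ := hV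
      exact ⟨htG, b, ⟨hxV, hVU⟩, ht⟩
    refine ⟨t, htR, fun y hy => ?_, ?_, ?_⟩
    · rw [e] at hy
      by_contra hyR
      exact (hVO hy.1).1 (subset_closure ⟨hy.2, hyR⟩)
    · rw [e]
      exact inter_subset_right
    · filter_upwards [(hM.isOpen_of_isBasisSet hV).mem_nhds hxV] with y hy hyG
      rw [e]
      exact ⟨hy, hyG⟩

end IsSidedNhd

theorem HasTwoPointBoundaries.exists_isOrderChart
    (h2 : HasTwoPointBoundaries (Mt := Mt) (Mb := Mb) φ)
    (hM : IsTTT (Mt := Mt) (Mb := Mb) φ) (hdim : IsOneDimensional L Mt Mb) {C : Set Mt} {x : Mt}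
    (hCo : IsOpen C) (hC : DefinableSet L Mb C) (hx : Splits C x) :
    ∃ (D : Set Mt) (lt : Mt → Mt → Prop), IsOrderChart L Mb D lt ∧ x ∈ D ∧
      (∃ d ∈ D, lt d x) ∧ ∃ d ∈ D, lt x d := by
  have := hM.hausdorff
  set H := interior Cᶜ with hH
  have hHo : IsOpen H := isOpen_interior
  have hHd : DefinableSet L Mb H := hM.definableSet_interior hC.compl
  have hCH : Disjoint C H := disjoint_left.2 fun y hy hy' => interior_subset hy' hy
  have hxC : x ∈ closure C := closure_mono sdiff_subset hx.1
  have hxH : x ∈ closure H := hM.mem_closure_interior hdim hC.compl hx.2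
  obtain ⟨U₁, hU₁, hxU₁, hV₁⟩ := hM.exists_nhds_frontier_inter_nonempty hdim hCo hC hxC
    (mem_closure_of_disjoint hCo hCH hxH)
  obtain ⟨U₂, hU₂, hxU₂, hV₂⟩ := hM.exists_nhds_frontier_inter_nonempty hdim hHo hHd hxH
    (mem_closure_of_disjoint hHo hCH.symm hxC)
  obtain ⟨U₀, hU₀, hxU₀, hE⟩ := hM.exists_nhds_frontier_subset hx.not_isOpen_singleton
  have hF : ((frontier C ∪ frontier H) \ {x}).Finite :=
    ((hM.finite_frontier hdim hC).union (hM.finite_frontier hdim hHd)).subset sdiff_subset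
  obtain ⟨U, hUb, hxU, hUU⟩ := hM.exists_isBasisSet_closure_subset hdim
    (((hU₁.inter hU₂).inter hU₀).sdiff hF.isClosed)
    (⟨⟨⟨hxU₁, hxU₂⟩, hxU₀⟩, fun h => h.2 rfl⟩ :
      x ∈ ((U₁ ∩ U₂) ∩ U₀) \ ((frontier C ∪ frontier H) \ {x}))
  have hUo := hM.isOpen_of_isBasisSet hUb
  have hUd := IsBasisSet.definableSet hUb
  have hfr : ∀ y ∈ closure U, y ∈ frontier C ∪ frontier H → y = x := fun y hy hy' => by
    by_contra hne
    exact (hUU hy).2 ⟨hy', hne⟩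
  have hsC : ∀ V : Set Mt, IsBasisSet (Mb := Mb) φ V → x ∈ V → V ⊆ U →
      (frontier V ∩ C).Nonempty := fun V hV hxV hVU =>
    hV₁ V (fun y hy => (hUU (subset_closure (hVU hy))).1.1.1) (hM.isOpen_of_isBasisSet hV)
      (IsBasisSet.definableSet hV) hxV
  have hsH : ∀ V : Set Mt, IsBasisSet (Mb := Mb) φ V → x ∈ V → V ⊆ U →
      (frontier V ∩ H).Nonempty := fun V hV hxV hVU =>
    hV₂ V (fun y hy => (hUU (subset_closure (hVU hy))).1.1.2) (hM.isOpen_of_isBasisSet hV)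
      (IsBasisSet.definableSet hV) hxV
  have hE' : ∀ Y ⊆ closure U, IsOpen Y → DefinableSet L Mb Y → frontier Y ⊆ {x} → Y = ∅ :=
    fun Y hY => hE Y fun y hy => (hUU (hY hy)).1.2
  have s1 : IsSidedNhd (Mb := Mb) φ x C H U := ⟨hCo, hHo, hC, hHd, hCH, hxC, hxH, hUo, hUd, hxU,
    fun y hy hy' => hfr y hy (.inl hy'), hE', hsC, hsH⟩
  have s2 : IsSidedNhd (Mb := Mb) φ x H C U := ⟨hHo, hCo, hHd, hC, hCH.symm, hxH, hxC, hUo, hUd,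
    hxU, fun y hy hy' => hfr y hy (.inr hy'), hE', hsH, hsC⟩
  obtain ⟨R, A, hA, t, ht, htR, htG, hev⟩ := s1.exists_isHalfChart h2 hM hdim
  obtain ⟨R', B, hB, t', ht', htR', htG', hev'⟩ := s2.exists_isHalfChart h2 hM hdim
  refine hA.exists_isOrderChart hB hM ht htR ht' htR' (hCH.mono htG htG') ?_
  rw [eventually_nhdsWithin_iff]
  filter_upwards [hev, hev', hUo.mem_nhds hxU] with y h1 h2 h3 h4
  by_cases hyC : y ∈ C
  · exact .inl (h1 hyC)
  · refine .inr (h2 ?_)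
    by_contra hyH
    refine h4 (hfr y (subset_closure h3) (.inl ?_))
    rw [← frontier_compl]
    exact ⟨subset_closure hyC, hyH⟩

/-- Take `V` around `x` with closure in `D` and avoiding points `d < x < e`. Its boundary points are
some `a` in `(d, x)` and `b` in `(x, e)`, and since membership in `V` can change only at these two,
`V` is the interval `(a, b)`. -/
theorem HasTwoPointBoundaries.exists_isBasisSet
    (h2 : HasTwoPointBoundaries (Mt := Mt) (Mb := Mb) φ)
    (hM : IsTTT (Mt := Mt) (Mb := Mb) φ) (hdim : IsOneDimensional L Mt Mb) {D : Set Mt}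
    {lt : Mt → Mt → Prop} (h : IsOrderChart L Mb D lt) {x : Mt} (hx : x ∈ D)
    (hlo : ∃ d ∈ D, lt d x) (hup : ∃ d ∈ D, lt x d) :
    ∃ U : Set Mt, IsBasisSet (Mb := Mb) φ U ∧ x ∈ U ∧ IsOrderChart L Mb U lt := by
  have := hM.hausdorff
  let _ := h.linearOrder
  obtain ⟨d, hd, hdx⟩ := hlo
  obtain ⟨e, he, hxe⟩ := hup
  lift x to D using hx
  lift d to D using hd
  lift e to D using he
  replace hdx : d < x := hdx
  replace hxe : x < e := hxe
  have hxd' : (x : Mt) ≠ d := fun h' => hdx.ne' (Subtype.ext h')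
  have hxe' : (x : Mt) ≠ e := fun h' => hxe.ne (Subtype.ext h')
  obtain ⟨V, hV, hxV, hVD⟩ := hM.exists_isBasisSet_closure_subset hdim
    ((h.isOpen.sdiff isClosed_singleton).sdiff isClosed_singleton)
    (⟨⟨x.2, hxd'⟩, hxe'⟩ : (x : Mt) ∈ (D \ {(d : Mt)}) \ {(e : Mt)})
  have hVo := hM.isOpen_of_isBasisSet hV
  have hVd := IsBasisSet.definableSet hV
  have hdV : (d : Mt) ∉ closure V := fun h' => (hVD h').1.2 rfl
  have heV : (e : Mt) ∉ closure V := fun h' => (hVD h').2 rfl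
  have hVD' : V ⊆ D := fun y hy => (hVD (subset_closure hy)).1.1
  have hbd : ∀ p q : D, p < q → ¬ ((p : Mt) ∈ V ↔ (q : Mt) ∈ V) →
      ∃ z : D, p ≤ z ∧ z ≤ q ∧ (z : Mt) ∈ frontier V := by
    intro p q hpq hne
    by_cases hp : (p : Mt) ∈ V
    · obtain ⟨z, hz, h1, h3, h4⟩ := h.ivt p p.2 q q.2 hpq V hVd hp (by tauto)
      exact ⟨⟨z, hz⟩, not_lt.1 h1, not_lt.1 h3, h4⟩
    · have hq : (q : Mt) ∉ Vᶜ := fun hq => by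
        rw [mem_compl_iff] at hq
        tauto
      obtain ⟨z, hz, h1, h3, h4⟩ := h.ivt p p.2 q q.2 hpq Vᶜ hVd.compl hp hq
      rw [frontier_compl] at h4
      exact ⟨⟨z, hz⟩, not_lt.1 h1, not_lt.1 h3, h4⟩
  have hd' : (d : Mt) ∉ V := fun h' => hdV (subset_closure h')
  have he' : (e : Mt) ∉ V := fun h' => heV (subset_closure h')
  obtain ⟨a, hda, hax, haf⟩ := hbd d x hdx (by tauto)
  obtain ⟨b, hxb, hbe, hbf⟩ := hbd x e hxe (by tauto)
  have hfV : ∀ z : D, (z : Mt) ∈ frontier V → (z : Mt) ∉ V := fun z hz => by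
    rw [hVo.frontier_eq] at hz
    exact hz.2
  replace hda : d < a := hda.lt_of_ne fun h' => hdV (h' ▸ haf.1)
  replace hbe : b < e := hbe.lt_of_ne fun h' => heV (h' ▸ hbf.1)
  replace hax : a < x := hax.lt_of_ne fun h' => hfV a haf (h' ▸ hxV)
  replace hxb : x < b := hxb.lt_of_ne fun h' => hfV b hbf (h' ▸ hxV)
  replace hbd : ∀ p q : D, p < q → ¬ ((p : Mt) ∈ V ↔ (q : Mt) ∈ V) →
      (p ≤ a ∧ a ≤ q) ∨ (p ≤ b ∧ b ≤ q) := by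
    intro p q hpq hne
    obtain ⟨z, h1, h3, h4⟩ := hbd p q hpq hne
    by_cases hza : z = a
    · exact .inl (hza ▸ ⟨h1, h3⟩)
    · have : z = b := Subtype.ext (encard_eq_two_unique (h2 V hV ⟨x, hxV⟩) h4 hbf haf
        (fun h' => hza (Subtype.ext h')) fun h' => (hax.trans hxb).ne' (Subtype.ext h'))
      exact .inr (this ▸ ⟨h1, h3⟩)
  -- Membership differs at `y` and `d`, but neither `a` nor `b` lies between them if `y < a`.
  have hlow : ∀ y : D, (y : Mt) ∈ V → a < y := by
    intro y hy
    by_contra hya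
    rcases lt_trichotomy d y with hdy | rfl | hdy
    · have hya' : y ≠ a := fun h' => hfV a haf (h' ▸ hy)
      have := hbd d y hdy (by tauto)
      grind
    · exact hd' hy
    · have := hbd y d hdy (by tauto)
      grind
  have hupp : ∀ y : D, (y : Mt) ∈ V → y < b := by
    intro y hy
    by_contra hyb
    rcases lt_trichotomy y e with hye | rfl | hye
    · have hyb' : y ≠ b := fun h' => hfV b hbf (h' ▸ hy)
      have := hbd y e hye (by tauto)
      grind
    · exact he' hy
    · have := hbd e y hye (by tauto)
      grind
  refine ⟨V, hV, hxV, h.restrict hVo hVd hVD' fun r hr s hs z hz hrz hzs => ?_⟩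
  by_contra hzV
  have h1 : a < ⟨z, hz⟩ := (hlow ⟨r, hVD' hr⟩ hr).trans hrz
  have h3 : (⟨z, hz⟩ : D) < b := lt_trans hzs (hupp ⟨s, hVD' hs⟩ hs)
  rcases lt_trichotomy (⟨z, hz⟩ : D) x with hzx | hzx | hzx
  · have := hbd _ _ hzx (by tauto)
    grind
  · subst hzx
    exact hzV hxV
  · have := hbd _ _ hzx (by tauto)
    grind

end TTT

theorem mainTheorem2 (L : FirstOrder.Language.{u, v}) (Mt : Type w) (Mb : Type w')
    [L.Structure (Mt ⊕ Mb)] [TopologicalSpace Mt] (k : ℕ) (φ : L.Formula (Fin 1 ⊕ Fin k))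
    (hM : TTT.IsTTT (Mt := Mt) (Mb := Mb) φ) (hdim : TTT.IsOneDimensional L Mt Mb)
    (hsat : TTT.OmegaSaturated L (Mt ⊕ Mb))
    (hcond : TTT.HasDifferenceFun L Mt Mb ∨ TTT.HasTwoPointBoundaries (Mt := Mt) (Mb := Mb) φ) :
    ∃ E : Set Mt, E.Finite ∧ ∀ x ∉ E,
      (∃ D : Set Mt, x ∈ D ∧ IsOpen D ∧ TTT.DefinableSet L Mb D ∧ TTT.IsOMinimal L Mb D ∧
        ∀ U : Set Mt, TTT.IsBasisSet (Mb := Mb) φ U → U ⊆ D → TTT.compNum L Mb U = 1 →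
          TTT.IsOMinimal L Mb U) ∧
      (TTT.HasTwoPointBoundaries (Mt := Mt) (Mb := Mb) φ →
        ∃ U : Set Mt, TTT.IsBasisSet (Mb := Mb) φ U ∧ x ∈ U ∧ TTT.IsOMinimal L Mb U) := by
  have : Fact (TTT.IsTwoSorted L Mt Mb) := ⟨hM.twoSorted⟩
  -- The exceptional points are those split by no basis set, under either condition.
  refine ⟨_, hM.finite_not_splits hdim, fun x hx => ?_⟩
  obtain ⟨b, hb⟩ := not_not.1 hx
  have hC := TTT.DefinableSet.basisSet (Mt := Mt) φ b
  have hCo : IsOpen (TTT.basisSet φ b : Set Mt) := hM.isOpen_of_isBasisSet ⟨b, rfl⟩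
  obtain ⟨D, lt, hD, hxD, hlo, hup⟩ := hcond.elim
    (fun hF => hF.exists_isOrderChart hM hdim hC hb)
    (fun h2 => h2.exists_isOrderChart hM hdim hCo hC hb)
  refine ⟨⟨D, hxD, hD.isOpen, hD.definable, hD.isOMinimal hM hdim, fun U hU hUD hc => ?_⟩,
    fun h2 => ?_⟩
  · exact (hD.restrict_of_compNum (hM.isOpen_of_isBasisSet hU) hU.definableSet hUD hc).isOMinimal
      hM hdim
  · obtain ⟨U, hU, hxU, h⟩ := h2.exists_isBasisSet hM hdim hD hxD hlo hup
    exact ⟨U, hU, hxU, h.isOMinimal hM hdim⟩
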